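/- **Setting.** Let $Z$ be a random element of a measurable space with law $P$, let $\Theta\subseteq\mathbb R^d$ be convex, and let $L(z;\theta)$ be a real loss, measurable in $z$ for each $\theta\in\Theta$ and, for every $z$, three times continuously differentiable in $\theta$ in a neighbourhood of each point of $\Theta$; derivatives $\nabla,\nabla^2,\nabla^3$ are with respect to $\theta$. Assume that $E[L(Z;\theta)]$ exists and is finite for all $\theta\in\Theta$ and that it has a unique minimizer $\theta_0$ over $\Theta$, which lies in the interior of $\Theta$. Put $H=E[\nabla^2L(Z;\theta_0)]$ and $V_{11}=E[\nabla L(Z;\theta_0)\nabla L(Z;\theta_0)^{\top}]$. Assume: (C1) there are functions $G_1,G_2,G_3$ with $E[G_k(Z)^2]<\infty$ such that $\|\nabla^kL(z;\theta_1)-\nabla^kL(z;\theta_2)\|\le G_k(z)\|\theta_1-\theta_2\|$ for all $z$, all $\theta_1,\theta_2\in\Theta$ and $k=1,2,3$; (C2) for some $\tau>0$, $E\|\nabla L(Z;\theta_0)\|^{2+\tau}<\infty$, $E\|\nabla^2L(Z;\theta_0)\|^{2+\tau}<\infty$ and $E\|\nabla^3L(Z;\theta_0)\|^{2}<\infty$;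 (C3) the smallest eigenvalue of $H$ is bounded away from zero, i.e. it is at least some $c>0$. Let $Z_1,Z_2,\dots$ be i.i.d. copies of $Z$. For each $N$ let $n=n_N$ be the expected subsample size and let $R_1,\dots,R_N\in\{0,1\}$ (depending on $N$) be such that the pairs $(Z_i,R_i)$, $i\le N$, are independent and $P(R_i=1\mid Z_i)=n/N$; put $S=\{i\le N: R_i=1\}$. Let $\hat\theta_{\rm full}$ and $\tilde\theta_{\rm uni}$ be $\Theta$-valued random vectors which, with probability tending to one, minimize $\theta\mapsto\frac1N\sum_{i=1}^NL(Z_i;\theta)$ and $\theta\mapsto\sum_{i\in S}L(Z_i;\theta)$, respectively, over $\Theta$. Assume that both are asymptotically tight in $\Theta$: for every $\varepsilon>0$ there is a compact $K\subseteq\Theta$ that contains the estimator with probability at least $1-\varepsilon$ for all large $N$ (this is automatic if $\Theta$ is compact). The subsampled one-step estimator is $$\tilde\theta_{\rm SOS}=\tilde\theta_{\rm uni}-\Big(\frac1n\sum_{i\in S}\nabla^2L(Z_i;\tilde\theta_{\rm uni})\Big)^{-1}\frac1N\sum_{i=1}^N\nabla L(Z_i;\tilde\theta_{\rm uni}),$$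 where the inverse is read as $0$ if the matrix is singular. **Theorem 2.** If $N\to\infty$ and $n/\sqrt N\to\infty$, then $$\sqrt N(\tilde\theta_{\rm SOS}-\hat\theta_{\rm full})\to0\quad\text{in probability},$$ and $\sqrt N(\tilde\theta_{\rm SOS}-\theta_0)$ converges in distribution to $N(0,H^{-1}V_{11}H^{-1})$, which is also the limit in distribution of $\sqrt N(\hat\theta_{\rm full}-\theta_0)$. -/

import Mathlib

open MeasureTheory ProbabilityTheory Filter Topology

noncomputable section

namespace SOS

variable {d : ℕ} {𝓩 Ω : Type*}

/-- The parameter space `ℝ^d` with its Euclidean norm. -/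
abbrev Vec (d : ℕ) : Type := EuclideanSpace ℝ (Fin d)

/-- The Hessian matrix `∇² f(θ)`, with entries `∂_i ∂_j f(θ)`. -/
def hessian (f : Vec d → ℝ) (θ : Vec d) : Matrix (Fin d) (Fin d) ℝ :=
  Matrix.of fun i j =>
    iteratedFDeriv ℝ 2 f θ ![EuclideanSpace.single i 1, EuclideanSpace.single j 1]

/-- The index set `S = {i | R_i = 1}` of the subsample of the first `N` observations
(observations are numbered from `0`). -/
def subsample (N : ℕ) (R : ℕ → Bool) : Finset ℕ :=
  {i ∈ Finset.range N | R i = true}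

/-- `θ` is a minimizer over `Θ` of the empirical loss `∑ i ∈ S, L(z_i; ·)`.  A positive
normalizing factor in front of the sum does not change the minimizers. -/
def IsMEstimate (L : 𝓩 → Vec d → ℝ) (Θ : Set (Vec d)) (S : Finset ℕ) (z : ℕ → 𝓩)
    (θ : Vec d) : Prop :=
  θ ∈ Θ ∧ ∀ θ' ∈ Θ, ∑ i ∈ S, L (z i) θ ≤ ∑ i ∈ S, L (z i) θ'

/-- The subsampled one-step estimate
`θ - (n⁻¹ ∑_{i ∈ S} ∇² L(z_i; θ))⁻¹ (N⁻¹ ∑_{i < N} ∇ L(z_i; θ))`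
started at `θ`.  (If the averaged Hessian is singular, Mathlib's matrix inverse is `0`.) -/
def oneStep (L : 𝓩 → Vec d → ℝ) (n : ℝ) (N : ℕ) (S : Finset ℕ) (z : ℕ → 𝓩)
    (θ : Vec d) : Vec d :=
  θ - Matrix.toEuclideanLin (n⁻¹ • ∑ i ∈ S, hessian (L (z i)) θ)⁻¹
    ((N : ℝ)⁻¹ • ∑ i ∈ Finset.range N, gradient (L (z i)) θ)

section Population

variable [MeasurableSpace 𝓩]

/-- `θ₀` is the (unique) minimizer over `Θ` of the population loss `θ ↦ E[L(Z; θ)]`, where `P`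
is the law of `Z`; the population loss is required to be well defined on `Θ`. -/
def IsPopulationArgmin (L : 𝓩 → Vec d → ℝ) (Θ : Set (Vec d)) (P : Measure 𝓩)
    (θ₀ : Vec d) : Prop :=
  θ₀ ∈ Θ ∧ (∀ θ ∈ Θ, Integrable (fun z => L z θ) P) ∧
    ∀ θ ∈ Θ, θ ≠ θ₀ → ∫ z, L z θ₀ ∂P < ∫ z, L z θ ∂P

/-- The matrix `H = E[∇² L(Z; θ₀)]`. -/
def meanHessian (L : 𝓩 → Vec d → ℝ) (P : Measure 𝓩) (θ₀ : Vec d) :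
    Matrix (Fin d) (Fin d) ℝ :=
  Matrix.of fun i j => ∫ z, hessian (L z) θ₀ i j ∂P

/-- The matrix `V₁₁ = E[∇ L(Z; θ₀) ∇ L(Z; θ₀)ᵀ]`. -/
def gradientSecondMoment (L : 𝓩 → Vec d → ℝ) (P : Measure 𝓩) (θ₀ : Vec d) :
    Matrix (Fin d) (Fin d) ℝ :=
  Matrix.of fun i j => ∫ z, gradient (L z) θ₀ i * gradient (L z) θ₀ j ∂P

/-- Condition (C1): the first three derivatives of the loss in `θ` are Lipschitz on `Θ`, with
Lipschitz constants `G₁(z), G₂(z), G₃(z)` such that `E[G_k(Z)²] < ∞`.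
(`∇^k L` is Mathlib's iterated derivative with its operator norm; for `k = 1, 2` this is the
Euclidean norm of the gradient and the spectral norm of the Hessian.) -/
def CondC1 (L : 𝓩 → Vec d → ℝ) (Θ : Set (Vec d)) (P : Measure 𝓩) : Prop :=
  ∃ G : ℕ → 𝓩 → ℝ, ∀ k ∈ Finset.Icc 1 3, MemLp (G k) 2 P ∧
    ∀ z, ∀ θ₁ ∈ Θ, ∀ θ₂ ∈ Θ,
      ‖iteratedFDeriv ℝ k (L z) θ₁ - iteratedFDeriv ℝ k (L z) θ₂‖ ≤ G k z * ‖θ₁ - θ₂‖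

/-- Condition (C2): for some `τ > 0`, `E‖∇ L(Z; θ₀)‖^{2+τ}`, `E‖∇² L(Z; θ₀)‖^{2+τ}` and
`E‖∇³ L(Z; θ₀)‖²` are finite. -/
def CondC2 (L : 𝓩 → Vec d → ℝ) (P : Measure 𝓩) (θ₀ : Vec d) : Prop :=
  ∃ τ : ℝ, 0 < τ ∧
    MemLp (fun z => iteratedFDeriv ℝ 1 (L z) θ₀) (ENNReal.ofReal (2 + τ)) P ∧
    MemLp (fun z => iteratedFDeriv ℝ 2 (L z) θ₀) (ENNReal.ofReal (2 + τ)) P ∧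
    MemLp (fun z => iteratedFDeriv ℝ 3 (L z) θ₀) 2 P

/-- Condition (C3): the eigenvalues of `H = E[∇² L(Z; θ₀)]` are bounded away from zero from
below. -/
def CondC3 (L : 𝓩 → Vec d → ℝ) (P : Measure 𝓩) (θ₀ : Vec d) : Prop :=
  ∃ c : ℝ, 0 < c ∧ ∀ ev : ℝ,
    Module.End.HasEigenvalue (Matrix.toLin' (meanHessian L P θ₀)) ev → c ≤ ev

end Population

section Sampling

variable [MeasurableSpace 𝓩] [MeasurableSpace Ω]

/-- Uniform (Bernoulli) subsampling with expected subsample size `n` out of `N`: the pairs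
`(Z_i, R_i)`, `i < N`, are independent and `P(R_i = 1 ∣ Z_i) = n / N`, that is, `R_i` is
independent of `Z_i` and equals `1` with probability `n / N`.  (For `0 < N` the last clause
forces `0 ≤ n ≤ N`.) -/
structure IsUniformSubsampling (μ : Measure Ω) (Z : ℕ → Ω → 𝓩) (n : ℝ) (N : ℕ)
    (R : ℕ → Ω → Bool) : Prop where
  measurable : ∀ i < N, Measurable (R i)
  indep : iIndepFun (fun (i : Fin N) ω => (Z i ω, R i ω)) μ
  indep_obs : ∀ i < N, IndepFun (Z i) (R i) μ
  prob : ∀ i < N, μ.real {ω | R i ω = true} = n / N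

/-- The random vectors `T_N` are asymptotically tight in `Θ`: for every `ε > 0` there is a
compact `K ⊆ Θ` with `P(T_N ∉ K) ≤ ε` for all large `N`.  If `Θ` is compact, every sequence of
`Θ`-valued random vectors has this property. -/
def IsTightIn (μ : Measure Ω) (Θ : Set (Vec d)) (T : ℕ → Ω → Vec d) : Prop :=
  ∀ ε : ENNReal, 0 < ε → ∃ K ⊆ Θ, IsCompact K ∧ ∀ᶠ N in atTop, μ {ω | T N ω ∉ K} ≤ ε

end Sampling

end SOS

end

set_option linter.unusedSectionVars false

/-! The one-step error is a product of two small factors. With `b = N^(1/4)`, so that `b² = √N`, the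
assumption `n/√N → ∞` says `b²/n → 0`. Chebyshev's inequality then makes centred means over the
subsample, which have size `n^(-1/2)`, negligible after multiplication by `b`; the same holds for
full-sample means, since `b²/N → 0`.

Write `H` for the population Hessian. A minimizer over a compact part of `Θ` is consistent by a Wald
covering argument. It is then eventually interior, so its score vanishes, and linearizing the score
at `θ₀` bounds its distance to `θ₀` by a constant times the norm of the score at `θ₀`. Hence both
estimators are within `o_P(1/b)` of `θ₀` (`tendsto_mul_norm_sub`).

If `B` is the subsample Hessian at the starting point `a` and `f` is a zero of the full score, then
`B (oneStep - f) = B (a - f) - score a`. Since `B` and the full-sample slope of the score are both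
within `o_P(1/b)` of `H`, the right side is `o_P(1/b)` times `‖a - θ₀‖ + ‖f - θ₀‖`, hence `o_P(1/b²)
= o_P(1/√N)`. Inverting `B` costs only a constant factor (`norm_oneStep_sub_le`).

The same product estimate shows that the full-data estimator equals `θ₀ - H⁻¹ score(θ₀)` up to
`o_P(1/√N)`. The central limit theorem and Slutsky's lemma give its limit law, and a second use of
Slutsky's lemma transfers it to the one-step estimator. Probabilistic limits are taken along
`probFilter`, so deterministic inequalities combine on events of probability tending to one. -/

namespace SOS

/-! ### Convergence in probability as a filter, and laws of large numbers for Bernoulli subsamples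
-/

section Probability

variable {𝓩 Ω : Type*} [MeasurableSpace 𝓩] [MeasurableSpace Ω]

/-- The filter of sets of pairs `(N, ω)` whose `N`-th sections have probability tending to one.
Convergence along it is convergence in probability. -/
def probFilter (μ : Measure Ω) : Filter (ℕ × Ω) where
  sets := {s | Tendsto (fun N => μ {ω | (N, ω) ∉ s}) atTop (𝓝 0)}
  univ_sets := by simp
  sets_of_superset {s t} hs hst := by
    refine tendsto_of_tendsto_of_tendsto_of_le_of_le tendsto_const_nhds hs (fun _ => zero_le)
      fun N => measure_mono fun ω hω h => hω (hst h)
  inter_sets {s t} hs ht := by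
    have h := Tendsto.add hs ht
    rw [add_zero] at h
    refine tendsto_of_tendsto_of_tendsto_of_le_of_le tendsto_const_nhds h (fun _ => zero_le)
      fun N => (measure_mono fun ω hω => ?_).trans (measure_union_le _ _)
    by_contra hc
    simp only [Set.mem_union, Set.mem_ofPred_eq, not_or, not_not] at hc
    exact hω hc

theorem eventually_probFilter {μ : Measure Ω} {p : ℕ × Ω → Prop} :
    (∀ᶠ x in probFilter μ, p x) ↔ Tendsto (fun N => μ {ω | ¬ p (N, ω)}) atTop (𝓝 0) :=
  Iff.rfl

theorem tendsto_fst_probFilter (μ : Measure Ω) : Tendsto Prod.fst (probFilter μ) atTop := by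
  intro s hs
  refine eventually_probFilter.2 (tendsto_const_nhds.congr' ?_)
  filter_upwards [hs] with N hN
  simp [hN]

theorem tendstoInMeasure_zero_of_probFilter {E : Type*} [SeminormedAddCommGroup E]
    {μ : Measure Ω} {X : ℕ → Ω → E}
    (h : Tendsto (fun x : ℕ × Ω => ‖X x.1 x.2‖) (probFilter μ) (𝓝 0)) :
    TendstoInMeasure μ X atTop (fun _ => 0) := by
  rw [tendstoInMeasure_iff_norm]
  intro ε hε
  have := eventually_probFilter.1 (h.eventually_lt_const hε)
  simpa using this

theorem eventually_probFilter_of_forall_le {μ : Measure Ω} {p : ℕ × Ω → Prop}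
    (h : ∀ ε : ENNReal, 0 < ε → ∀ᶠ N in atTop, μ {ω | ¬ p (N, ω)} ≤ ε) :
    ∀ᶠ x in probFilter μ, p x := by
  rw [eventually_probFilter, ENNReal.tendsto_nhds_zero]
  exact fun ε hε => h ε hε

variable {μ : Measure Ω} {P : Measure 𝓩}
  {Z : ℕ → Ω → 𝓩}

/-- The normalized sum `n⁻¹ ∑_{i ∈ S} f(z_i)`. -/
noncomputable def wavg {E : Type*} [AddCommMonoid E] [Module ℝ E] (n : ℝ) (S : Finset ℕ)
    (z : ℕ → 𝓩) (f : 𝓩 → E) : E :=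
  n⁻¹ • ∑ i ∈ S, f (z i)

theorem memLp_indicator_comp {N : ℕ} {n : ℝ} {R : ℕ → Ω → Bool} {f : 𝓩 → ℝ}
    (hR : IsUniformSubsampling μ Z n N R) (hZ : ∀ i, HasLaw (Z i) P μ) (hf : MemLp f 2 P)
    {i : ℕ} (hi : i < N) :
    MemLp (fun ω => if R i ω = true then f (Z i ω) else 0) 2 μ := by
  have hm : MeasurableSet {ω | R i ω = true} := hR.measurable i hi (measurableSet_singleton true)
  have h : MemLp (fun ω => f (Z i ω)) 2 μ := by
    have := hf
    rw [← (hZ i).map_eq] at this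
    exact this.comp_of_map (hZ i).aemeasurable
  convert h.indicator hm using 2 with ω
  simp only [Set.indicator_apply, Set.mem_ofPred_eq]

/-- Independence of `R i` and `Z i` factors the expectation into the selection probability and the
population mean. -/
theorem integral_indicator_comp {N : ℕ} {n : ℝ} {R : ℕ → Ω → Bool} {f : 𝓩 → ℝ}
    (hR : IsUniformSubsampling μ Z n N R) (hZ : ∀ i, HasLaw (Z i) P μ)
    (hf : AEStronglyMeasurable f P) {i : ℕ} (hi : i < N) :
    ∫ ω, (if R i ω = true then f (Z i ω) else 0) ∂μ = n / N * ∫ z, f z ∂P := by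
  have hm : MeasurableSet {ω | R i ω = true} := hR.measurable i hi (measurableSet_singleton true)
  have hind : IndepFun (fun ω => f (Z i ω)) (fun ω => if R i ω = true then (1 : ℝ) else 0) μ := by
    refine (hR.indep_obs i hi).comp₀ (φ := f) (ψ := fun b => if b = true then (1 : ℝ) else 0)
      (hZ i).aemeasurable (hR.measurable i hi).aemeasurable ?_ ?_
    · rw [(hZ i).map_eq]; exact hf.aemeasurable
    · exact (measurable_of_countable _).aemeasurable
  have hfm : AEStronglyMeasurable (fun ω => f (Z i ω)) μ := by
    have := hf
    rw [← (hZ i).map_eq] at this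
    exact this.comp_aemeasurable (hZ i).aemeasurable
  have h1 : ∫ ω, (if R i ω = true then (1 : ℝ) else 0) ∂μ = n / N := by
    rw [← hR.prob i hi, ← integral_indicator_one hm]
    simp only [Set.indicator_apply, Set.mem_ofPred_eq, Pi.one_apply]
  have h2 : ∫ ω, f (Z i ω) ∂μ = ∫ z, f z ∂P := by
    have := hf
    rw [← (hZ i).map_eq] at this
    rw [← integral_map (hZ i).aemeasurable this, (hZ i).map_eq]
  have h3 := hind.integral_fun_mul_eq_mul_integral hfm
    (((measurable_of_countable fun b : Bool => if b = true then (1 : ℝ) else 0).comp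
      (hR.measurable i hi)).aestronglyMeasurable)
  rw [h2] at h3
  have h4 : (fun ω => if R i ω = true then f (Z i ω) else 0) =
      fun ω => f (Z i ω) * (if R i ω = true then (1 : ℝ) else 0) := by
    ext ω; split_ifs <;> simp
  rw [h4]
  refine h3.trans ?_
  rw [mul_comm]
  congr 1

theorem pairwise_indep_indicator {N : ℕ} {n : ℝ} {R : ℕ → Ω → Bool} {f : 𝓩 → ℝ}
    (hR : IsUniformSubsampling μ Z n N R) (hZ : ∀ i, HasLaw (Z i) P μ)
    (hf : AEStronglyMeasurable f P) :
    Set.Pairwise (↑(Finset.range N)) fun i j =>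
      IndepFun (fun ω => if R i ω = true then f (Z i ω) else 0)
        (fun ω => if R j ω = true then f (Z j ω) else 0) μ := by
  intro i hi j hj hij
  simp only [Finset.coe_range, Set.mem_Iio] at hi hj
  have h := hR.indep.indepFun (i := ⟨i, hi⟩) (j := ⟨j, hj⟩) (by simpa using hij)
  have hpair : ∀ k < N, AEMeasurable (fun ω => (Z k ω, R k ω)) μ := fun k hk =>
    (hZ k).aemeasurable.prodMk (hR.measurable k hk).aemeasurable
  have hg : ∀ k < N, AEMeasurable (fun p : 𝓩 × Bool => if p.2 = true then f p.1 else 0)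
      (μ.map (fun ω => (Z k ω, R k ω))) := by
    intro k hk
    have hfst : AEMeasurable (fun p : 𝓩 × Bool => f p.1) (μ.map (fun ω => (Z k ω, R k ω))) := by
      refine AEMeasurable.comp_aemeasurable (g := f) (f := Prod.fst) ?_ measurable_fst.aemeasurable
      rw [AEMeasurable.map_map_of_aemeasurable measurable_fst.aemeasurable (hpair k hk)]
      change AEMeasurable f (μ.map (Z k))
      rw [(hZ k).map_eq]
      exact hf.aemeasurable
    convert hfst.indicator (s := {p : 𝓩 × Bool | p.2 = true})
      (measurable_snd (measurableSet_singleton true)) using 2 with p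
    simp only [Set.indicator_apply, Set.mem_ofPred_eq]
  exact h.comp₀ (φ := fun p : 𝓩 × Bool => if p.2 = true then f p.1 else 0)
    (ψ := fun p : 𝓩 × Bool => if p.2 = true then f p.1 else 0) (hpair i hi) (hpair j hj)
    (hg i hi) (hg j hj)

/-- Chebyshev's inequality for the mean over a Bernoulli subsample. -/
theorem measure_wavg_sub_le [IsProbabilityMeasure μ] {N : ℕ} {n : ℝ} {R : ℕ → Ω → Bool} {f : 𝓩 → ℝ}
    (hR : IsUniformSubsampling μ Z n N R) (hZ : ∀ i, HasLaw (Z i) P μ) (hf : MemLp f 2 P)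
    (hn : 0 < n) (hN : 0 < N) {δ : ℝ} (hδ : 0 < δ) :
    μ {ω | δ ≤ |wavg n (subsample N fun i => R i ω) (fun i => Z i ω) f - ∫ z, f z ∂P|} ≤
      ENNReal.ofReal ((∫ z, f z ^ 2 ∂P) / n / δ ^ 2) := by
  set X : ℕ → Ω → ℝ := fun i ω => if R i ω = true then f (Z i ω) else 0 with hX
  have hXm : ∀ i ∈ Finset.range N, MemLp (X i) 2 μ := fun i hi =>
    memLp_indicator_comp hR hZ hf (Finset.mem_range.1 hi)
  have hN' : (N : ℝ) ≠ 0 := by positivity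
  have hsum : MemLp (∑ i ∈ Finset.range N, X i) 2 μ := memLp_finsetSum' _ hXm
  have hmean : ∫ ω, (∑ i ∈ Finset.range N, X i) ω ∂μ = n * ∫ z, f z ∂P := by
    simp only [Finset.sum_apply]
    rw [integral_finsetSum _ fun i hi => (hXm i hi).integrable one_le_two,
      Finset.sum_congr rfl fun i hi =>
        integral_indicator_comp hR hZ hf.aestronglyMeasurable (Finset.mem_range.1 hi)]
    simp only [Finset.sum_const, Finset.card_range, nsmul_eq_mul]
    field_simp
  have hvar : variance (∑ i ∈ Finset.range N, X i) μ ≤ n * ∫ z, f z ^ 2 ∂P := by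
    rw [IndepFun.variance_sum hXm (pairwise_indep_indicator hR hZ hf.aestronglyMeasurable)]
    -- The variance is at most the second moment. Squaring leaves the selection indicator unchanged,
    -- so the expectation formula applies to `f²`.
    have : ∀ i ∈ Finset.range N, variance (X i) μ ≤ n / N * ∫ z, f z ^ 2 ∂P := by
      intro i hi
      refine (variance_le_expectation_sq (hXm i hi).aestronglyMeasurable).trans_eq ?_
      rw [← integral_indicator_comp hR hZ (f := fun z => f z ^ 2)
        (hf.aestronglyMeasurable.pow 2) (Finset.mem_range.1 hi)]
      congr 1
      ext ω
      simp only [hX, Pi.pow_apply]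
      split_ifs <;> simp
    refine (Finset.sum_le_sum this).trans_eq ?_
    simp only [Finset.sum_const, Finset.card_range, nsmul_eq_mul]
    field_simp
  have hset : {ω | δ ≤ |wavg n (subsample N fun i => R i ω) (fun i => Z i ω) f - ∫ z, f z ∂P|}
      = {ω | n * δ ≤ |(∑ i ∈ Finset.range N, X i) ω -
          ∫ ω, (∑ i ∈ Finset.range N, X i) ω ∂μ|} := by
    ext ω
    rw [Set.mem_ofPred_eq, Set.mem_ofPred_eq, hmean]
    have : (∑ i ∈ Finset.range N, X i) ω - n * ∫ z, f z ∂P =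
        n * (wavg n (subsample N fun i => R i ω) (fun i => Z i ω) f - ∫ z, f z ∂P) := by
      simp only [wavg, subsample, Finset.sum_filter, Finset.sum_apply, hX, smul_eq_mul]
      field_simp
    rw [this, abs_mul, abs_of_pos hn]
    exact (mul_le_mul_iff_right₀ hn).symm
  rw [hset]
  refine (meas_ge_le_variance_div_sq hsum (by positivity)).trans (ENNReal.ofReal_le_ofReal ?_)
  calc _ ≤ (n * ∫ z, f z ^ 2 ∂P) / (n * δ) ^ 2 := by gcongr
    _ = _ := by field_simp

/-- Weak law of large numbers with rate for Bernoulli subsamples. -/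
theorem tendsto_mul_wavg_sub [IsProbabilityMeasure μ] {n : ℕ → ℝ} {R : ℕ → ℕ → Ω → Bool} {f : 𝓩 → ℝ} {b : ℕ → ℝ}
    (hR : ∀ N, IsUniformSubsampling μ Z (n N) N (R N)) (hZ : ∀ i, HasLaw (Z i) P μ)
    (hf : MemLp f 2 P) (hn : Tendsto n atTop atTop)
    (hb : Tendsto (fun N => b N ^ 2 / n N) atTop (𝓝 0)) :
    Tendsto (fun x : ℕ × Ω => b x.1 * |wavg (n x.1) (subsample x.1 fun i => R x.1 i x.2)
      (fun i => Z i x.2) f - ∫ z, f z ∂P|) (probFilter μ) (𝓝 0) := by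
  rw [Metric.tendsto_nhds]
  intro ε hε
  rw [eventually_probFilter]
  have hlim : Tendsto (fun N => ENNReal.ofReal ((∫ z, f z ^ 2 ∂P) * (b N ^ 2 / n N) / ε ^ 2))
      atTop (𝓝 0) := by
    have := ENNReal.tendsto_ofReal ((hb.const_mul (∫ z, f z ^ 2 ∂P)).div_const (ε ^ 2))
    simpa using this
  refine tendsto_of_tendsto_of_tendsto_of_le_of_le' tendsto_const_nhds hlim
    (Eventually.of_forall fun _ => zero_le) ?_
  filter_upwards [hn.eventually_gt_atTop 0, eventually_gt_atTop 0] with N hnN hN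
  -- The Chebyshev threshold is `ε / |b N|`, so a vanishing `b N` is treated apart.
  rcases eq_or_ne (b N) 0 with h0 | h0
  · simp [h0, hε]
  have hb0 : 0 < |b N| := abs_pos.2 h0
  refine (measure_mono ?_).trans ((measure_wavg_sub_le (hR N) hZ hf hnN hN
    (div_pos hε hb0)).trans_eq ?_)
  · intro ω hω
    simp only [Set.mem_ofPred_eq, not_lt, dist_zero_right, norm_mul, Real.norm_eq_abs,
      abs_abs] at hω ⊢
    rwa [div_le_iff₀' hb0]
  · congr 1
    rw [div_pow, sq_abs]
    field_simp

end Probability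

/-! ### Gradients and Hessians in Euclidean coordinates -/

section Calculus

variable {d : ℕ}

/-- The Hessian matrix as a continuous linear operator on Euclidean space. -/
noncomputable def hessCLM (f : Vec d → ℝ) (θ : Vec d) : Vec d →L[ℝ] Vec d :=
  Matrix.toEuclideanCLM (𝕜 := ℝ) (hessian f θ)

theorem inner_gradient (f : Vec d → ℝ) (θ v : Vec d) :
    inner ℝ (gradient f θ) v = fderiv ℝ f θ v := by
  simp [gradient]

theorem gradient_apply (f : Vec d → ℝ) (θ : Vec d) (i : Fin d) :
    gradient f θ i = fderiv ℝ f θ (EuclideanSpace.single i 1) := by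
  rw [← inner_gradient, EuclideanSpace.inner_single_right]
  simp

theorem hessian_apply (f : Vec d → ℝ) (θ : Vec d) (i j : Fin d) :
    hessian f θ i j = fderiv ℝ (fderiv ℝ f) θ (EuclideanSpace.single i 1)
      (EuclideanSpace.single j 1) := by
  simp [hessian, iteratedFDeriv_two_apply]

theorem fderiv_fderiv_symm {f : Vec d → ℝ} {θ : Vec d} (hf : ContDiffAt ℝ 3 f θ) (v w : Vec d) :
    fderiv ℝ (fderiv ℝ f) θ v w = fderiv ℝ (fderiv ℝ f) θ w v :=
  (hf.isSymmSndFDerivAt (by simp; norm_num)).eq v w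

theorem hessian_symm {f : Vec d → ℝ} {θ : Vec d} (hf : ContDiffAt ℝ 3 f θ) (i j : Fin d) :
    hessian f θ i j = hessian f θ j i := by
  rw [hessian_apply, hessian_apply, fderiv_fderiv_symm hf]

/-- Two bilinear forms that agree on basis vectors are equal. The matrix action puts the two indices
in the opposite order, which symmetry of the second derivative repairs. -/
theorem inner_hessCLM {f : Vec d → ℝ} {θ : Vec d} (hf : ContDiffAt ℝ 3 f θ) (v w : Vec d) :
    inner ℝ (hessCLM f θ v) w = fderiv ℝ (fderiv ℝ f) θ v w := by
  set B : Vec d →ₗ[ℝ] Vec d →ₗ[ℝ] ℝ :=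
    (ContinuousLinearMap.coeLM ℝ).comp (fderiv ℝ (fderiv ℝ f) θ).toLinearMap
  have h : (innerₗ (Vec d)).comp (hessCLM f θ).toLinearMap = B := by
    refine (EuclideanSpace.basisFun (Fin d) ℝ).toBasis.ext fun j =>
      (EuclideanSpace.basisFun (Fin d) ℝ).toBasis.ext fun i => ?_
    simp only [OrthonormalBasis.coe_toBasis, EuclideanSpace.basisFun_apply]
    change inner ℝ (hessCLM f θ (EuclideanSpace.single j 1)) (EuclideanSpace.single i 1) =
      fderiv ℝ (fderiv ℝ f) θ (EuclideanSpace.single j 1) (EuclideanSpace.single i 1)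
    rw [← hessian_apply, hessian_symm hf, EuclideanSpace.inner_single_right]
    simp [hessCLM]
  exact LinearMap.congr_fun (LinearMap.congr_fun h v) w

theorem hasFDerivAt_gradient {f : Vec d → ℝ} {θ : Vec d} (hf : ContDiffAt ℝ 3 f θ) :
    HasFDerivAt (gradient f) (hessCLM f θ) θ := by
  have h1 : HasFDerivAt (fderiv ℝ f) (fderiv ℝ (fderiv ℝ f) θ) θ := by
    refine DifferentiableAt.hasFDerivAt ?_
    exact (hf.fderiv_right (m := 2) (by norm_num)).differentiableAt (by norm_num)
  have h2 := ((InnerProductSpace.toDual ℝ (Vec d)).symm.toContinuousLinearEquiv.toContinuousLinearMap.restrictScalars ℝ).hasFDerivAt.comp θ h1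
  refine h2.congr_fderiv ?_
  ext1 v
  refine ext_inner_right ℝ fun w => ?_
  rw [inner_hessCLM hf]
  simp

/-- Evaluating the difference of bilinear forms at `v` and at its own image `w` gives `‖w‖²`; one
factor `‖w‖` then cancels. -/
theorem norm_hessCLM_sub_le {f : Vec d → ℝ} {a b : Vec d} (ha : ContDiffAt ℝ 3 f a)
    (hb : ContDiffAt ℝ 3 f b) :
    ‖hessCLM f a - hessCLM f b‖ ≤ ‖iteratedFDeriv ℝ 2 f a - iteratedFDeriv ℝ 2 f b‖ := by
  refine ContinuousLinearMap.opNorm_le_bound _ (norm_nonneg _) fun v => ?_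
  set w := (hessCLM f a - hessCLM f b) v with hw
  have h1 : ‖w‖ * ‖w‖ ≤ ‖iteratedFDeriv ℝ 2 f a - iteratedFDeriv ℝ 2 f b‖ * ‖v‖ * ‖w‖ := by
    have := (iteratedFDeriv ℝ 2 f a - iteratedFDeriv ℝ 2 f b).le_opNorm ![v, w]
    rw [sub_apply, iteratedFDeriv_two_apply,
      iteratedFDeriv_two_apply] at this
    simp only [Matrix.cons_val_zero, Matrix.cons_val_one, Fin.prod_univ_two] at this
    rw [← inner_hessCLM ha, ← inner_hessCLM hb, ← inner_sub_left,
      ← sub_apply, ← hw, real_inner_self_eq_norm_mul_norm,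
      Real.norm_of_nonneg (by positivity)] at this
    linarith
  rcases (norm_nonneg w).eq_or_lt with h0 | h0
  · rw [← h0]; positivity
  · exact le_of_mul_le_mul_right h1 h0

/-- Mean value inequality on the ball for the gradient minus its linearization at the centre: the
derivative of this difference is at most `G * r` there. -/
theorem norm_sub_sub_hessCLM_le {f : Vec d → ℝ} {θ₀ a b : Vec d} {r G : ℝ}
    {Θ : Set (Vec d)} (hf : ∀ θ ∈ Θ, ContDiffAt ℝ 3 f θ)
    (hsub : Metric.closedBall θ₀ r ⊆ Θ) (hG : 0 ≤ G)
    (hlip : ∀ θ₁ ∈ Θ, ∀ θ₂ ∈ Θ,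
      ‖iteratedFDeriv ℝ 2 f θ₁ - iteratedFDeriv ℝ 2 f θ₂‖ ≤ G * ‖θ₁ - θ₂‖)
    (ha : a ∈ Metric.closedBall θ₀ r) (hb : b ∈ Metric.closedBall θ₀ r) :
    ‖gradient f a - gradient f b - hessCLM f θ₀ (a - b)‖ ≤ G * r * ‖a - b‖ := by
  have hr : 0 ≤ r := dist_nonneg.trans ha
  have h0 : θ₀ ∈ Metric.closedBall θ₀ r := Metric.mem_closedBall_self hr
  refine (convex_closedBall θ₀ r).norm_image_sub_le_of_norm_hasFDerivWithin_le'
    (f := gradient f) (f' := hessCLM f)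
    (fun x hx => (hasFDerivAt_gradient (hf x (hsub hx))).hasFDerivWithinAt) (fun x hx => ?_) hb ha
  refine (norm_hessCLM_sub_le (hf x (hsub hx)) (hf θ₀ (hsub h0))).trans
    ((hlip x (hsub hx) θ₀ (hsub h0)).trans ?_)
  gcongr
  rwa [← dist_eq_norm]

theorem abs_gradient_apply_le (f : Vec d → ℝ) (θ : Vec d) (i : Fin d) :
    |gradient f θ i| ≤ ‖iteratedFDeriv ℝ 1 f θ‖ := by
  have := (iteratedFDeriv ℝ 1 f θ).le_opNorm (fun _ => EuclideanSpace.single i 1)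
  simpa [gradient_apply] using this

theorem abs_hessian_apply_le (f : Vec d → ℝ) (θ : Vec d) (i j : Fin d) :
    |hessian f θ i j| ≤ ‖iteratedFDeriv ℝ 2 f θ‖ := by
  have := (iteratedFDeriv ℝ 2 f θ).le_opNorm
    ![EuclideanSpace.single i 1, EuclideanSpace.single j 1]
  simpa [hessian, Fin.prod_univ_two] using this

theorem norm_le_sum_abs (x : Vec d) : ‖x‖ ≤ ∑ i, |x i| := by
  have h : x = ∑ i, x i • EuclideanSpace.single i (1 : ℝ) := by
    simpa using ((EuclideanSpace.basisFun (Fin d) ℝ).sum_repr x).symm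
  calc ‖x‖ = ‖∑ i, x i • EuclideanSpace.single i (1 : ℝ)‖ := by rw [← h]
    _ ≤ ∑ i, ‖x i • EuclideanSpace.single i (1 : ℝ)‖ := norm_sum_le _ _
    _ = _ := by simp [norm_smul]

/-- Reduces convergence of random matrices to the scalar law of large numbers for each entry. -/
theorem norm_toEuclideanCLM_le_sum_abs (M : Matrix (Fin d) (Fin d) ℝ) :
    ‖Matrix.toEuclideanCLM (𝕜 := ℝ) M‖ ≤ ∑ i, ∑ j, |M i j| := by
  refine ContinuousLinearMap.opNorm_le_bound _ (by positivity) fun v => ?_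
  refine (norm_le_sum_abs _).trans ?_
  rw [Finset.sum_mul]
  refine Finset.sum_le_sum fun i _ => ?_
  have : Matrix.toEuclideanCLM (𝕜 := ℝ) M v i = ∑ j, M i j * v j := by
    simp [Matrix.mulVec, dotProduct]
  rw [this, Finset.sum_mul]
  refine (Finset.abs_sum_le_sum_abs _ _).trans (Finset.sum_le_sum fun j _ => ?_)
  rw [abs_mul]
  gcongr
  exact PiLp.norm_apply_le v j

end Calculus

/-! ### Consistency of M-estimators by a compactness argument -/

section Consistency

variable {d : ℕ} {𝓩 Ω : Type*} [MeasurableSpace 𝓩] [MeasurableSpace Ω]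
  {L : 𝓩 → Vec d → ℝ} {Θ : Set (Vec d)} {P : Measure 𝓩} {θ₀ : Vec d} {G : 𝓩 → ℝ}

/-- A Lipschitz constant of the loss on `Θ ∩ closedBall θ₀ ρ`. -/
noncomputable def envelope (L : 𝓩 → Vec d → ℝ) (θ₀ : Vec d) (G : 𝓩 → ℝ) (ρ : ℝ) (z : 𝓩) : ℝ :=
  ‖iteratedFDeriv ℝ 1 (L z) θ₀‖ + |G z| * ρ

theorem abs_loss_sub_le (hΘ : Convex ℝ Θ) (h0 : θ₀ ∈ Θ)
    (hsmooth : ∀ z, ∀ θ ∈ Θ, ContDiffAt ℝ 3 (L z) θ)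
    (hG : ∀ z, ∀ θ₁ ∈ Θ, ∀ θ₂ ∈ Θ,
      ‖iteratedFDeriv ℝ 1 (L z) θ₁ - iteratedFDeriv ℝ 1 (L z) θ₂‖ ≤ G z * ‖θ₁ - θ₂‖)
    {ρ : ℝ} {a b : Vec d} (ha : a ∈ Θ ∩ Metric.closedBall θ₀ ρ)
    (hb : b ∈ Θ ∩ Metric.closedBall θ₀ ρ) (z : 𝓩) :
    |L z a - L z b| ≤ envelope L θ₀ G ρ z * ‖a - b‖ := by
  refine Convex.norm_image_sub_le_of_norm_fderiv_le (f := L z) (𝕜 := ℝ)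
    (s := Θ ∩ Metric.closedBall θ₀ ρ)
    (fun x hx => (hsmooth z x hx.1).differentiableAt (by norm_num)) (fun x hx => ?_)
    (hΘ.inter (convex_closedBall θ₀ ρ)) hb ha
  rw [← norm_iteratedFDeriv_one (f := L z) (x := x) (𝕜 := ℝ)]
  calc ‖iteratedFDeriv ℝ 1 (L z) x‖
      ≤ ‖iteratedFDeriv ℝ 1 (L z) θ₀‖ +
        ‖iteratedFDeriv ℝ 1 (L z) x - iteratedFDeriv ℝ 1 (L z) θ₀‖ := by
          have := norm_add_le (iteratedFDeriv ℝ 1 (L z) θ₀)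
            (iteratedFDeriv ℝ 1 (L z) x - iteratedFDeriv ℝ 1 (L z) θ₀)
          rwa [add_sub_cancel] at this
    _ ≤ ‖iteratedFDeriv ℝ 1 (L z) θ₀‖ + |G z| * ρ := by
          gcongr
          refine (hG z x hx.1 θ₀ h0).trans ?_
          have h1 : ‖x - θ₀‖ ≤ ρ := by rw [← dist_eq_norm]; exact hx.2
          exact mul_le_mul (le_abs_self _) h1 (norm_nonneg _) (abs_nonneg _)

theorem memLp_envelope (hD : MemLp (fun z => iteratedFDeriv ℝ 1 (L z) θ₀) 2 P)
    (hGm : MemLp G 2 P) (ρ : ℝ) : MemLp (envelope L θ₀ G ρ) 2 P :=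
  hD.norm.add (hGm.norm.mul_const ρ)

theorem envelope_nonneg {ρ : ℝ} (hρ : 0 ≤ ρ) (z : 𝓩) : 0 ≤ envelope L θ₀ G ρ z := by
  unfold envelope; positivity

/-- The loss is only assumed integrable, but its increments are dominated by the square-integrable
envelope. Consistency is therefore argued with increments, for which Chebyshev's inequality is
available. -/
theorem memLp_loss_sub (hΘ : Convex ℝ Θ) (h0 : θ₀ ∈ Θ) (hmeas : ∀ θ ∈ Θ, Measurable fun z => L z θ)
    (hsmooth : ∀ z, ∀ θ ∈ Θ, ContDiffAt ℝ 3 (L z) θ)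
    (hG : ∀ z, ∀ θ₁ ∈ Θ, ∀ θ₂ ∈ Θ,
      ‖iteratedFDeriv ℝ 1 (L z) θ₁ - iteratedFDeriv ℝ 1 (L z) θ₂‖ ≤ G z * ‖θ₁ - θ₂‖)
    (hD : MemLp (fun z => iteratedFDeriv ℝ 1 (L z) θ₀) 2 P) (hGm : MemLp G 2 P)
    {θ : Vec d} (hθ : θ ∈ Θ) : MemLp (fun z => L z θ - L z θ₀) 2 P := by
  refine MemLp.mono ((memLp_envelope hD hGm ‖θ - θ₀‖).mul_const ‖θ - θ₀‖)
    ((hmeas θ hθ).sub (hmeas θ₀ h0)).aestronglyMeasurable (Eventually.of_forall fun z => ?_)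
  have h1 : θ ∈ Θ ∩ Metric.closedBall θ₀ ‖θ - θ₀‖ := ⟨hθ, by simp [dist_eq_norm]⟩
  have h2 : θ₀ ∈ Θ ∩ Metric.closedBall θ₀ ‖θ - θ₀‖ := ⟨h0, by simp⟩
  rw [Real.norm_eq_abs]
  exact (abs_loss_sub_le hΘ h0 hsmooth hG h1 h2 z).trans (le_abs_self _)

theorem abs_wavg_le {n : ℝ} (hn : 0 ≤ n) (S : Finset ℕ) (z : ℕ → 𝓩) {f g : 𝓩 → ℝ}
    (h : ∀ z, |f z| ≤ g z) : |wavg n S z f| ≤ wavg n S z g := by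
  unfold wavg
  rw [smul_eq_mul, smul_eq_mul, abs_mul, abs_of_nonneg (inv_nonneg.2 hn)]
  gcongr
  exact (Finset.abs_sum_le_sum_abs _ _).trans (Finset.sum_le_sum fun i _ => h _)

variable {μ : Measure Ω} [IsProbabilityMeasure μ] [IsProbabilityMeasure P] {Z : ℕ → Ω → 𝓩}
  {n : ℕ → ℝ} {R : ℕ → ℕ → Ω → Bool}

theorem tendsto_wavg {f : 𝓩 → ℝ}
    (hR : ∀ N, IsUniformSubsampling μ Z (n N) N (R N)) (hZ : ∀ i, HasLaw (Z i) P μ)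
    (hf : MemLp f 2 P) (hn : Tendsto n atTop atTop) :
    Tendsto (fun x : ℕ × Ω => wavg (n x.1) (subsample x.1 fun i => R x.1 i x.2)
      (fun i => Z i x.2) f) (probFilter μ) (𝓝 (∫ z, f z ∂P)) := by
  have := tendsto_mul_wavg_sub (b := fun _ => 1) hR hZ hf hn
    (by simpa [Function.comp_def] using tendsto_inv_atTop_zero.comp hn)
  rw [tendsto_iff_dist_tendsto_zero]
  simpa [Real.dist_eq] using this

/-- Wald's argument: each point of `K` has positive mean excess loss, the law of large numbers
carries this to the sample, the envelope carries it to a small ball, and finitely many balls cover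
`K`. -/
theorem eventually_forall_compact_wavg_pos (hΘ : Convex ℝ Θ)
    (hmeas : ∀ θ ∈ Θ, Measurable fun z => L z θ)
    (hsmooth : ∀ z, ∀ θ ∈ Θ, ContDiffAt ℝ 3 (L z) θ) (hargmin : IsPopulationArgmin L Θ P θ₀)
    (hG : ∀ z, ∀ θ₁ ∈ Θ, ∀ θ₂ ∈ Θ,
      ‖iteratedFDeriv ℝ 1 (L z) θ₁ - iteratedFDeriv ℝ 1 (L z) θ₂‖ ≤ G z * ‖θ₁ - θ₂‖)
    (hD : MemLp (fun z => iteratedFDeriv ℝ 1 (L z) θ₀) 2 P) (hGm : MemLp G 2 P)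
    (hZ : ∀ i, HasLaw (Z i) P μ) (hR : ∀ N, IsUniformSubsampling μ Z (n N) N (R N))
    (hn : Tendsto n atTop atTop) {K : Set (Vec d)} (hK : IsCompact K) (hKΘ : K ⊆ Θ)
    (hK0 : θ₀ ∉ K) :
    ∀ᶠ x : ℕ × Ω in probFilter μ, ∀ θ ∈ K,
      0 < wavg (n x.1) (subsample x.1 fun i => R x.1 i x.2) (fun i => Z i x.2)
        (fun z => L z θ - L z θ₀) := by
  obtain ⟨ρ, hρ⟩ := hK.isBounded.subset_closedBall θ₀
  set ρ' := max ρ 0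
  have hρ' : K ⊆ Metric.closedBall θ₀ ρ' :=
    hρ.trans (Metric.closedBall_subset_closedBall (le_max_left _ _))
  have hm : MemLp (envelope L θ₀ G ρ') 2 P := memLp_envelope hD hGm ρ'
  set m := ∫ z, envelope L θ₀ G ρ' z ∂P
  have hm0 : 0 ≤ m := integral_nonneg fun z => envelope_nonneg (le_max_right _ _) z
  -- The induction runs over sets that may leave `K`, while the estimates hold only on `K`; hence
  -- the intersection.
  suffices h : ∀ᶠ x : ℕ × Ω in probFilter μ, ∀ θ ∈ K ∩ K,
      0 < wavg (n x.1) (subsample x.1 fun i => R x.1 i x.2) (fun i => Z i x.2)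
        (fun z => L z θ - L z θ₀) by simpa using h
  refine hK.induction_on (p := fun s => ∀ᶠ x : ℕ × Ω in probFilter μ, ∀ θ ∈ s ∩ K,
      0 < wavg (n x.1) (subsample x.1 fun i => R x.1 i x.2) (fun i => Z i x.2)
        (fun z => L z θ - L z θ₀)) (by simp) ?_ ?_ ?_
  · intro s t hst ht
    filter_upwards [ht] with x hx θ hθ using hx θ ⟨hst hθ.1, hθ.2⟩
  · intro s t hs ht
    filter_upwards [hs, ht] with x hx hx' θ hθ
    exact hθ.1.elim (fun h => hx θ ⟨h, hθ.2⟩) fun h => hx' θ ⟨h, hθ.2⟩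
  intro θ hθ
  have hlpos : 0 < ∫ z, (L z θ - L z θ₀) ∂P := by
    rw [integral_sub (hargmin.2.1 θ (hKΘ hθ)) (hargmin.2.1 θ₀ hargmin.1), sub_pos]
    exact hargmin.2.2 θ (hKΘ hθ) fun h => hK0 (h ▸ hθ)
  set l := ∫ z, (L z θ - L z θ₀) ∂P
  -- The mean envelope is eventually below `m + 1`, so on a ball of this radius the averaged loss
  -- moves by at most `l / 2`, whereas at the centre its excess is above `l / 2`.
  have hr : 0 < l / 2 / (m + 1) := by positivity
  refine ⟨Metric.ball θ (l / 2 / (m + 1)), mem_nhdsWithin_of_mem_nhds (Metric.ball_mem_nhds θ hr),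
    ?_⟩
  have h1 := (tendsto_wavg hR hZ (memLp_loss_sub hΘ hargmin.1 hmeas hsmooth hG hD hGm (hKΘ hθ))
    hn).eventually_const_lt (half_lt_self hlpos)
  have h2 := (tendsto_wavg hR hZ hm hn).eventually_lt_const (lt_add_one m)
  have h3 := (tendsto_fst_probFilter μ).eventually (hn.eventually_gt_atTop 0)
  filter_upwards [h1, h2, h3] with x hx1 hx2 hx3 θ' hθ'
  set S := subsample x.1 fun i => R x.1 i x.2
  have hle := abs_wavg_le hx3.le S (fun i => Z i x.2)
    (f := fun z => (L z θ' - L z θ₀) - (L z θ - L z θ₀))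
    (g := fun z => envelope L θ₀ G ρ' z * ‖θ' - θ‖) fun z => by
      rw [sub_sub_sub_cancel_right]
      exact abs_loss_sub_le hΘ hargmin.1 hsmooth hG ⟨hKΘ hθ'.2, hρ' hθ'.2⟩ ⟨hKΘ hθ, hρ' hθ⟩ z
  have e1 : wavg (n x.1) S (fun i => Z i x.2) (fun z => (L z θ' - L z θ₀) - (L z θ - L z θ₀)) =
      wavg (n x.1) S (fun i => Z i x.2) (fun z => L z θ' - L z θ₀) -
      wavg (n x.1) S (fun i => Z i x.2) (fun z => L z θ - L z θ₀) := by
    simp only [wavg, Finset.sum_sub_distrib, smul_sub]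
  have e2 : wavg (n x.1) S (fun i => Z i x.2) (fun z => envelope L θ₀ G ρ' z * ‖θ' - θ‖) =
      wavg (n x.1) S (fun i => Z i x.2) (envelope L θ₀ G ρ') * ‖θ' - θ‖ := by
    simp only [wavg, Finset.sum_mul, smul_eq_mul, mul_assoc]
  rw [e1, e2] at hle
  have h4 : ‖θ' - θ‖ ≤ l / 2 / (m + 1) := by
    rw [← dist_eq_norm]; exact (Metric.mem_ball.1 hθ'.1).le
  have h5 : wavg (n x.1) S (fun i => Z i x.2) (envelope L θ₀ G ρ') * ‖θ' - θ‖ ≤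
      (m + 1) * (l / 2 / (m + 1)) := by gcongr
  rw [mul_div_cancel₀ _ (by positivity)] at h5
  have := (abs_le.1 hle).1
  linarith

/-- Consistency of tight M-estimators based on Bernoulli subsamples. -/
theorem tendsto_norm_sub_of_isMEstimate (hΘ : Convex ℝ Θ)
    (hmeas : ∀ θ ∈ Θ, Measurable fun z => L z θ)
    (hsmooth : ∀ z, ∀ θ ∈ Θ, ContDiffAt ℝ 3 (L z) θ) (hargmin : IsPopulationArgmin L Θ P θ₀)
    (hG : ∀ z, ∀ θ₁ ∈ Θ, ∀ θ₂ ∈ Θ,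
      ‖iteratedFDeriv ℝ 1 (L z) θ₁ - iteratedFDeriv ℝ 1 (L z) θ₂‖ ≤ G z * ‖θ₁ - θ₂‖)
    (hD : MemLp (fun z => iteratedFDeriv ℝ 1 (L z) θ₀) 2 P) (hGm : MemLp G 2 P)
    (hZ : ∀ i, HasLaw (Z i) P μ) (hR : ∀ N, IsUniformSubsampling μ Z (n N) N (R N))
    (hn : Tendsto n atTop atTop) {T : ℕ → Ω → Vec d}
    (hT : ∀ᶠ x : ℕ × Ω in probFilter μ, IsMEstimate L Θ (subsample x.1 fun i => R x.1 i x.2)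
      (fun i => Z i x.2) (T x.1 x.2)) (htight : IsTightIn μ Θ T) :
    Tendsto (fun x : ℕ × Ω => ‖T x.1 x.2 - θ₀‖) (probFilter μ) (𝓝 0) := by
  rw [Metric.tendsto_nhds]
  intro δ hδ
  simp only [dist_zero_right, norm_norm]
  refine eventually_probFilter_of_forall_le fun ε hε => ?_
  obtain ⟨K, hKΘ, hK, hKT⟩ := htight (ε / 2) (ENNReal.half_pos hε.ne')
  have h := eventually_forall_compact_wavg_pos hΘ hmeas hsmooth hargmin hG hD hGm hZ hR hn
    (hK.diff (Metric.isOpen_ball (x := θ₀) (ε := δ))) (Set.sdiff_subset.trans hKΘ)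
    (fun h => h.2 (Metric.mem_ball_self hδ))
  have h3 := (tendsto_fst_probFilter μ).eventually (hn.eventually_gt_atTop 0)
  have h4 : ∀ᶠ x : ℕ × Ω in probFilter μ, T x.1 x.2 ∈ K → ‖T x.1 x.2 - θ₀‖ < δ := by
    filter_upwards [h, h3, hT] with x hx hx3 hxT hxK
    by_contra hc
    -- An estimate in `K` outside the ball around `θ₀` would have strictly larger empirical loss
    -- than `θ₀`, against minimality.
    have h5 := hx _ ⟨hxK, by rwa [Metric.mem_ball, dist_eq_norm]⟩
    have h6 := hxT.2 θ₀ hargmin.1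
    simp only [wavg, Finset.sum_sub_distrib, smul_eq_mul] at h5
    have := pos_of_mul_pos_right h5 (inv_nonneg.2 hx3.le)
    linarith
  have h5 := (ENNReal.tendsto_nhds_zero.1 (eventually_probFilter.1 h4)) (ε / 2)
    (ENNReal.half_pos hε.ne')
  filter_upwards [h5, hKT] with N h5 h6
  calc _ ≤ μ ({ω | ¬(T N ω ∈ K → ‖T N ω - θ₀‖ < δ)} ∪ {ω | T N ω ∉ K}) := by
        refine measure_mono fun ω hω => ?_
        by_cases hTK : T N ω ∈ K
        · exact Or.inl fun h => hω (h hTK)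
        · exact Or.inr hTK
    _ ≤ ε / 2 + ε / 2 := (measure_union_le _ _).trans (add_le_add h5 h6)
    _ = ε := ENNReal.add_halves ε

end Consistency

/-! ### First-order condition and invertibility of the Hessian in the population -/

section PopulationScore

variable {d : ℕ} {𝓩 : Type*} [MeasurableSpace 𝓩]
  {L : 𝓩 → Vec d → ℝ} {Θ : Set (Vec d)} {P : Measure 𝓩} [IsProbabilityMeasure P] {θ₀ : Vec d}
  {G : 𝓩 → ℝ}

theorem memLp_gradient_apply {p : ENNReal}
    (hD : MemLp (fun z => iteratedFDeriv ℝ 1 (L z) θ₀) p P) (i : Fin d) :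
    MemLp (fun z => gradient (L z) θ₀ i) p P := by
  refine MemLp.mono hD ?_ (Eventually.of_forall fun z => abs_gradient_apply_le _ _ _)
  have : (fun z => gradient (L z) θ₀ i) = fun z =>
      iteratedFDeriv ℝ 1 (L z) θ₀ (fun _ => EuclideanSpace.single i 1) := by
    ext z; simp [gradient_apply]
  rw [this]
  exact (ContinuousMultilinearMap.apply ℝ (fun _ : Fin 1 => Vec d) ℝ
    (fun _ => EuclideanSpace.single i 1)).continuous.comp_aestronglyMeasurable
      hD.aestronglyMeasurable

theorem memLp_hessian_apply {p : ENNReal}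
    (hD : MemLp (fun z => iteratedFDeriv ℝ 2 (L z) θ₀) p P) (i j : Fin d) :
    MemLp (fun z => hessian (L z) θ₀ i j) p P := by
  refine MemLp.mono hD ?_ (Eventually.of_forall fun z => abs_hessian_apply_le _ _ _ _)
  exact (ContinuousMultilinearMap.apply ℝ (fun _ : Fin 2 => Vec d) ℝ
    ![EuclideanSpace.single i 1, EuclideanSpace.single j 1]).continuous.comp_aestronglyMeasurable
      hD.aestronglyMeasurable

/-- The envelope is an integrable local Lipschitz constant, so differentiation passes under the
integral, and the derivative vanishes at an interior minimum. -/
theorem integral_gradient_apply_eq_zero (hΘ : Convex ℝ Θ) (hθ₀ : θ₀ ∈ interior Θ)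
    (hmeas : ∀ θ ∈ Θ, Measurable fun z => L z θ)
    (hsmooth : ∀ z, ∀ θ ∈ Θ, ContDiffAt ℝ 3 (L z) θ) (hargmin : IsPopulationArgmin L Θ P θ₀)
    (hG : ∀ z, ∀ θ₁ ∈ Θ, ∀ θ₂ ∈ Θ,
      ‖iteratedFDeriv ℝ 1 (L z) θ₁ - iteratedFDeriv ℝ 1 (L z) θ₂‖ ≤ G z * ‖θ₁ - θ₂‖)
    (hD : MemLp (fun z => iteratedFDeriv ℝ 1 (L z) θ₀) 2 P) (hGm : MemLp G 2 P) (i : Fin d) :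
    ∫ z, gradient (L z) θ₀ i ∂P = 0 := by
  have hfd : (fun z => fderiv ℝ (L z) θ₀) = fun z =>
      continuousMultilinearCurryFin1 ℝ (Vec d) ℝ (iteratedFDeriv ℝ 1 (L z) θ₀) := by
    ext z v; simp
  have hmeasD : AEStronglyMeasurable (fun z => fderiv ℝ (L z) θ₀) P := by
    rw [hfd]
    exact (continuousMultilinearCurryFin1 ℝ (Vec d) ℝ).continuous.comp_aestronglyMeasurable
      hD.aestronglyMeasurable
  have hnhds : Θ ∈ 𝓝 θ₀ := mem_interior_iff_mem_nhds.1 hθ₀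
  obtain ⟨hint, hder⟩ := hasFDerivAt_integral_of_dominated_loc_of_lip (𝕜 := ℝ)
    (F := fun θ z => L z θ) (x₀ := θ₀) (μ := P) (s := Θ ∩ Metric.closedBall θ₀ 1)
    (bound := envelope L θ₀ G 1)
    (F' := fun z => fderiv ℝ (L z) θ₀) (inter_mem hnhds (Metric.closedBall_mem_nhds θ₀ one_pos))
    (by filter_upwards [hnhds] with θ hθ using (hmeas θ hθ).aestronglyMeasurable)
    (hargmin.2.1 θ₀ hargmin.1) hmeasD
    (Eventually.of_forall fun z => LipschitzOnWith.of_dist_le_mul fun a ha b hb => by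
      rw [Real.dist_eq, dist_eq_norm, Real.coe_nnabs, abs_of_nonneg (envelope_nonneg zero_le_one z)]
      exact abs_loss_sub_le hΘ hargmin.1 hsmooth hG ha hb z)
    ((memLp_envelope hD hGm 1).integrable one_le_two)
    (Eventually.of_forall fun z =>
      ((hsmooth z θ₀ hargmin.1).differentiableAt (by norm_num)).hasFDerivAt)
  have hmin : IsLocalMin (fun θ => ∫ z, L z θ ∂P) θ₀ := by
    filter_upwards [hnhds] with θ hθ
    rcases eq_or_ne θ θ₀ with h | h
    · rw [h]
    · exact (hargmin.2.2 θ hθ h).le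
  have h0 := hmin.hasFDerivAt_eq_zero hder
  simp only [gradient_apply]
  rw [← ContinuousLinearMap.integral_apply hint, h0]
  simp

theorem meanHessian_symm (hθ₀ : θ₀ ∈ Θ) (hsmooth : ∀ z, ∀ θ ∈ Θ, ContDiffAt ℝ 3 (L z) θ)
    (i j : Fin d) : meanHessian L P θ₀ i j = meanHessian L P θ₀ j i := by
  simp only [meanHessian, Matrix.of_apply]
  exact integral_congr_ae (Eventually.of_forall fun z => hessian_symm (hsmooth z θ₀ hθ₀) i j)

/-- A kernel vector would be an eigenvector for the eigenvalue `0`, which lies below `c`. -/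
theorem isUnit_det_meanHessian (hC3 : CondC3 L P θ₀) : IsUnit (meanHessian L P θ₀).det := by
  obtain ⟨c, hc, hev⟩ := hC3
  by_contra h
  rw [isUnit_iff_ne_zero, not_not] at h
  obtain ⟨v, hv, hv0⟩ := Matrix.exists_mulVec_eq_zero_iff.2 h
  refine hc.not_ge (hev 0 (Module.End.hasEigenvalue_of_hasEigenvector (x := v) ⟨?_, hv⟩))
  rw [Module.End.mem_eigenspace_iff]
  simpa using hv0

end PopulationScore

/-! ### Deterministic linearization and the one-step error bound -/

section Rate

variable {d : ℕ} {𝓩 Ω : Type*} [MeasurableSpace 𝓩] [MeasurableSpace Ω]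
  {L : 𝓩 → Vec d → ℝ} {Θ : Set (Vec d)} {P : Measure 𝓩} {θ₀ : Vec d} {G₁ G₂ : 𝓩 → ℝ}

/-- The regularity conditions on the loss, with square integrable Lipschitz constants `G₁`, `G₂`
of its gradient and Hessian. -/
structure IsRegularLoss (L : 𝓩 → Vec d → ℝ) (Θ : Set (Vec d)) (P : Measure 𝓩) (θ₀ : Vec d)
    (G₁ G₂ : 𝓩 → ℝ) : Prop where
  convex : Convex ℝ Θ
  mem_interior : θ₀ ∈ interior Θ
  meas : ∀ θ ∈ Θ, Measurable fun z => L z θ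
  smooth : ∀ z, ∀ θ ∈ Θ, ContDiffAt ℝ 3 (L z) θ
  argmin : IsPopulationArgmin L Θ P θ₀
  lip₁ : ∀ z, ∀ θ₁ ∈ Θ, ∀ θ₂ ∈ Θ,
      ‖iteratedFDeriv ℝ 1 (L z) θ₁ - iteratedFDeriv ℝ 1 (L z) θ₂‖ ≤ G₁ z * ‖θ₁ - θ₂‖
  lip₂ : ∀ z, ∀ θ₁ ∈ Θ, ∀ θ₂ ∈ Θ,
      ‖iteratedFDeriv ℝ 2 (L z) θ₁ - iteratedFDeriv ℝ 2 (L z) θ₂‖ ≤ G₂ z * ‖θ₁ - θ₂‖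
  memLp_lip₁ : MemLp G₁ 2 P
  memLp_lip₂ : MemLp G₂ 2 P
  memLp_fderiv₁ : MemLp (fun z => iteratedFDeriv ℝ 1 (L z) θ₀) 2 P
  memLp_fderiv₂ : MemLp (fun z => iteratedFDeriv ℝ 2 (L z) θ₀) 2 P
  isUnit_det : IsUnit (meanHessian L P θ₀).det

/-- The mean score. -/
noncomputable def score (L : 𝓩 → Vec d → ℝ) (n : ℝ) (S : Finset ℕ) (z : ℕ → 𝓩) (θ : Vec d) :
    Vec d :=
  wavg n S z fun z => gradient (L z) θ

/-- The mean Hessian, as an operator. -/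
noncomputable def meanHess (L : 𝓩 → Vec d → ℝ) (n : ℝ) (S : Finset ℕ) (z : ℕ → 𝓩) (θ : Vec d) :
    Vec d →L[ℝ] Vec d :=
  wavg n S z fun z => hessCLM (L z) θ

/-- The matrix `H`, as an operator. -/
noncomputable def popHess (L : 𝓩 → Vec d → ℝ) (P : Measure 𝓩) (θ₀ : Vec d) :
    Vec d →L[ℝ] Vec d :=
  Matrix.toEuclideanCLM (𝕜 := ℝ) (meanHessian L P θ₀)

/-- The matrix `H⁻¹`, as an operator. -/
noncomputable def popHessInv (L : 𝓩 → Vec d → ℝ) (P : Measure 𝓩) (θ₀ : Vec d) :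
    Vec d →L[ℝ] Vec d :=
  Matrix.toEuclideanCLM (𝕜 := ℝ) (meanHessian L P θ₀)⁻¹

theorem meanHess_eq (n : ℝ) (S : Finset ℕ) (z : ℕ → 𝓩) (θ : Vec d) :
    meanHess L n S z θ = Matrix.toEuclideanCLM (𝕜 := ℝ) (n⁻¹ • ∑ i ∈ S, hessian (L (z i)) θ) := by
  rw [map_smul, map_sum]
  rfl

theorem norm_wavg_le {E : Type*} [SeminormedAddCommGroup E] [NormedSpace ℝ E] {n : ℝ}
    (hn : 0 ≤ n) (S : Finset ℕ) (z : ℕ → 𝓩) {f : 𝓩 → E} {g : 𝓩 → ℝ} (h : ∀ z, ‖f z‖ ≤ g z) :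
    ‖wavg n S z f‖ ≤ wavg n S z g := by
  unfold wavg
  rw [norm_smul, Real.norm_of_nonneg (inv_nonneg.2 hn), smul_eq_mul]
  gcongr
  exact (norm_sum_le _ _).trans (Finset.sum_le_sum fun i _ => h _)

theorem wavg_mul (n : ℝ) (S : Finset ℕ) (z : ℕ → 𝓩) (f : 𝓩 → ℝ) (a : ℝ) :
    wavg n S z (fun z => f z * a) = wavg n S z f * a := by
  simp only [wavg, Finset.sum_mul, smul_eq_mul, mul_assoc]

theorem wavg_abs_nonneg {n : ℝ} (hn : 0 ≤ n) (S : Finset ℕ) (z : ℕ → 𝓩) (f : 𝓩 → ℝ) :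
    0 ≤ wavg n S z fun z => |f z| := by
  unfold wavg; positivity

namespace IsRegularLoss

variable (h : IsRegularLoss L Θ P θ₀ G₁ G₂)
include h

theorem mem : θ₀ ∈ Θ := interior_subset h.mem_interior

theorem popHessInv_popHess (x : Vec d) : popHessInv L P θ₀ (popHess L P θ₀ x) = x := by
  rw [popHessInv, popHess, ← mul_apply_eq_comp, ← map_mul,
    Matrix.nonsing_inv_mul _ h.isUnit_det]
  simp

theorem norm_le (x : Vec d) : ‖x‖ ≤ ‖popHessInv L P θ₀‖ * ‖popHess L P θ₀ x‖ := by
  have := (popHessInv L P θ₀).le_opNorm (popHess L P θ₀ x)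
  rwa [h.popHessInv_popHess] at this

theorem norm_score_sub_sub_le {n : ℝ} (hn : 0 ≤ n) (S : Finset ℕ) (z : ℕ → 𝓩) {r : ℝ}
    (hr : Metric.closedBall θ₀ r ⊆ Θ) {a b : Vec d} (ha : ‖a - θ₀‖ ≤ r) (hb : ‖b - θ₀‖ ≤ r) :
    ‖score L n S z a - score L n S z b - meanHess L n S z θ₀ (a - b)‖ ≤
      wavg n S z (fun z => |G₂ z|) * r * ‖a - b‖ := by
  have e : score L n S z a - score L n S z b - meanHess L n S z θ₀ (a - b) =
      wavg n S z fun z => gradient (L z) a - gradient (L z) b - hessCLM (L z) θ₀ (a - b) := by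
    simp only [score, meanHess, wavg, Finset.sum_sub_distrib, smul_sub,
      smul_apply, sum_apply]
  rw [e, mul_assoc, ← wavg_mul]
  refine norm_wavg_le hn S z fun z => ?_
  rw [← mul_assoc]
  refine norm_sub_sub_hessCLM_le (h.smooth z) hr (abs_nonneg _) (fun θ₁ h₁ θ₂ h₂ =>
    (h.lip₂ z θ₁ h₁ θ₂ h₂).trans ?_) (by rwa [Metric.mem_closedBall, dist_eq_norm])
    (by rwa [Metric.mem_closedBall, dist_eq_norm])
  gcongr
  exact le_abs_self _

theorem norm_meanHess_sub_le {n : ℝ} (hn : 0 ≤ n) (S : Finset ℕ) (z : ℕ → 𝓩) {a : Vec d}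
    (ha : a ∈ Θ) : ‖meanHess L n S z a - meanHess L n S z θ₀‖ ≤
      wavg n S z (fun z => |G₂ z|) * ‖a - θ₀‖ := by
  have e : meanHess L n S z a - meanHess L n S z θ₀ =
      wavg n S z fun z => hessCLM (L z) a - hessCLM (L z) θ₀ := by
    simp only [meanHess, wavg, Finset.sum_sub_distrib, smul_sub]
  rw [e, ← wavg_mul]
  refine norm_wavg_le hn S z fun z => ?_
  refine (norm_hessCLM_sub_le (h.smooth z a ha) (h.smooth z θ₀ h.mem)).trans
    ((h.lip₂ z a ha θ₀ h.mem).trans ?_)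
  gcongr
  exact le_abs_self _

theorem score_eq_zero {n : ℝ} {S : Finset ℕ} {z : ℕ → 𝓩} {θ : Vec d}
    (hM : IsMEstimate L Θ S z θ) (hθ : θ ∈ interior Θ) : score L n S z θ = 0 := by
  have hmin : IsLocalMin (fun θ => ∑ i ∈ S, L (z i) θ) θ := by
    filter_upwards [mem_interior_iff_mem_nhds.1 hθ] with θ' hθ' using hM.2 θ' hθ'
  have hder : HasFDerivAt (fun θ => ∑ i ∈ S, L (z i) θ) (∑ i ∈ S, fderiv ℝ (L (z i)) θ) θ :=
    HasFDerivAt.fun_sum fun i _ =>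
      ((h.smooth (z i) θ hM.1).differentiableAt (by norm_num)).hasFDerivAt
  have h0 := hmin.hasFDerivAt_eq_zero hder
  have : ∑ i ∈ S, gradient (L (z i)) θ = 0 := by
    simp only [gradient]
    rw [← map_sum, h0, map_zero]
  rw [score, wavg, this, smul_zero]

/-- The basic linearization at `θ₀` for a zero of the mean score. -/
theorem norm_score_add_popHess_le {n : ℝ} (hn : 0 ≤ n) {S : Finset ℕ} {z : ℕ → 𝓩} {θ : Vec d}
    (hball : Metric.closedBall θ₀ ‖θ - θ₀‖ ⊆ Θ) (h0 : score L n S z θ = 0) :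
    ‖score L n S z θ₀ + popHess L P θ₀ (θ - θ₀)‖ ≤
      (‖meanHess L n S z θ₀ - popHess L P θ₀‖ + wavg n S z (fun z => |G₂ z|) * ‖θ - θ₀‖) *
        ‖θ - θ₀‖ := by
  -- The radius is `‖θ - θ₀‖` itself, which makes the remainder quadratic.
  have h1 := h.norm_score_sub_sub_le hn S z hball le_rfl
    (b := θ₀) (by simp)
  rw [h0] at h1
  have e : score L n S z θ₀ + popHess L P θ₀ (θ - θ₀) =
      -(0 - score L n S z θ₀ - meanHess L n S z θ₀ (θ - θ₀)) -
        (meanHess L n S z θ₀ - popHess L P θ₀) (θ - θ₀) := by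
    rw [sub_apply]; abel
  rw [e]
  refine (norm_sub_le _ _).trans ?_
  rw [norm_neg, add_mul, add_comm]
  exact add_le_add (ContinuousLinearMap.le_opNorm _ _) h1

/-- Deterministic error bound for the one-step estimator started at `a`, relative to a zero `f` of
the full score. -/
theorem norm_oneStep_sub_le {n : ℝ} (hn : 0 ≤ n) {N : ℕ} {S : Finset ℕ} {z : ℕ → 𝓩}
    {a f : Vec d} (hball : Metric.closedBall θ₀ (‖a - θ₀‖ + ‖f - θ₀‖) ⊆ Θ)
    (hf : score L N (Finset.range N) z f = 0)
    (hsmall : ‖popHessInv L P θ₀‖ * (‖meanHess L n S z θ₀ - popHess L P θ₀‖ +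
      wavg n S z (fun z => |G₂ z|) * ‖a - θ₀‖) ≤ 1 / 2) :
    ‖oneStep L n N S z a - f‖ ≤ 2 * ‖popHessInv L P θ₀‖ *
      (((‖meanHess L n S z θ₀ - popHess L P θ₀‖ + wavg n S z (fun z => |G₂ z|) * ‖a - θ₀‖) +
        (‖meanHess L N (Finset.range N) z θ₀ - popHess L P θ₀‖ +
          wavg N (Finset.range N) z (fun z => |G₂ z|) * (‖a - θ₀‖ + ‖f - θ₀‖))) *
        (‖a - θ₀‖ + ‖f - θ₀‖)) := by
  set κ := ‖popHessInv L P θ₀‖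
  set H := popHess L P θ₀
  set B := meanHess L n S z a with hB
  set A := meanHess L N (Finset.range N) z θ₀
  set s := ‖meanHess L n S z θ₀ - H‖ + wavg n S z (fun z => |G₂ z|) * ‖a - θ₀‖
  set m := wavg (N : ℝ) (Finset.range N) z (fun z => |G₂ z|)
  set ρ := ‖a - θ₀‖ + ‖f - θ₀‖
  have haΘ : a ∈ Θ := hball (by rw [Metric.mem_closedBall, dist_eq_norm]; simp [ρ])
  have hBH : ‖B - H‖ ≤ s := by
    calc ‖B - H‖ = ‖(meanHess L n S z θ₀ - H) + (B - meanHess L n S z θ₀)‖ := by congr 1; abel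
      _ ≤ _ := (norm_add_le _ _).trans (add_le_add le_rfl (h.norm_meanHess_sub_le hn S z haΘ))
  have hκ : 0 ≤ κ := norm_nonneg _
  -- Perturbation of `H`: `‖x‖ ≤ κ ‖H x‖ ≤ κ ‖B x‖ + κ s ‖x‖`, and `κ s ≤ 1 / 2` lets the last term
  -- be absorbed.
  have hinj : ∀ x, ‖x‖ ≤ 2 * κ * ‖B x‖ := by
    intro x
    have h1 : ‖H x‖ ≤ ‖B x‖ + s * ‖x‖ := by
      calc ‖H x‖ = ‖B x - (B - H) x‖ := by rw [sub_apply]; congr 1; abel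
        _ ≤ ‖B x‖ + ‖(B - H) x‖ := norm_sub_le _ _
        _ ≤ _ := by gcongr; exact ((B - H).le_opNorm x).trans (by gcongr)
    have h2 := h.norm_le x
    have h3 : κ * ‖H x‖ ≤ κ * (‖B x‖ + s * ‖x‖) := by gcongr
    have h4 : κ * s * ‖x‖ ≤ 1 / 2 * ‖x‖ := by gcongr
    linarith
  set M := n⁻¹ • ∑ i ∈ S, hessian (L (z i)) a with hM
  have hBM : B = Matrix.toEuclideanCLM (𝕜 := ℝ) M := meanHess_eq n S z a
  -- The lower bound makes `M` injective, so the inverse in `oneStep` is genuine and not the default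
  -- `0`.
  have hdet : IsUnit M.det := by
    by_contra hc
    rw [isUnit_iff_ne_zero, not_not] at hc
    obtain ⟨v, hv, hv0⟩ := Matrix.exists_mulVec_eq_zero_iff.2 hc
    have h5 := hinj (WithLp.toLp 2 v)
    rw [hBM, Matrix.toEuclideanCLM_toLp, hv0] at h5
    simp only [WithLp.toLp_zero, norm_zero, mul_zero] at h5
    exact hv (by simpa using h5)
  have hBinv : ∀ y, B (Matrix.toEuclideanLin M⁻¹ y) = y := by
    intro y
    rw [hBM]
    change Matrix.toEuclideanCLM (𝕜 := ℝ) M (Matrix.toEuclideanCLM (𝕜 := ℝ) M⁻¹ y) = y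
    rw [← mul_apply_eq_comp, ← map_mul, Matrix.mul_nonsing_inv _ hdet]
    simp
  have hstep : B (oneStep L n N S z a - f) = B (a - f) - score L N (Finset.range N) z a := by
    have : oneStep L n N S z a - f =
        (a - f) - Matrix.toEuclideanLin M⁻¹ (score L N (Finset.range N) z a) := by
      simp only [oneStep, score, wavg, hM]; abel
    rw [this, map_sub, hBinv]
  have hexp := h.norm_score_sub_sub_le (Nat.cast_nonneg N) (Finset.range N) z (a := a) (b := f)
    hball (le_add_of_nonneg_right (norm_nonneg _)) (le_add_of_nonneg_left (norm_nonneg _))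
  rw [hf, sub_zero] at hexp
  have hm0 : 0 ≤ m := wavg_abs_nonneg (Nat.cast_nonneg N) _ _ _
  have haf : ‖a - f‖ ≤ ρ := by
    calc ‖a - f‖ = ‖(a - θ₀) - (f - θ₀)‖ := by congr 1; abel
      _ ≤ _ := norm_sub_le _ _
  have hBx : ‖B (oneStep L n N S z a - f)‖ ≤ (s + (‖A - H‖ + m * ρ)) * ρ := by
    rw [hstep]
    -- Both Hessians are compared with the same `H`, so only their deviations from `H` and the
    -- linearization error of the score remain.
    have e : B (a - f) - score L N (Finset.range N) z a =
        (B - H) (a - f) - (A - H) (a - f) -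
          (score L N (Finset.range N) z a - A (a - f)) := by
      rw [sub_apply, sub_apply]; abel
    calc _ ≤ s * ‖a - f‖ + ‖A - H‖ * ‖a - f‖ + m * ρ * ‖a - f‖ := by
          rw [e]
          refine (norm_sub_le _ _).trans (add_le_add ((norm_sub_le _ _).trans (add_le_add ?_ ?_))
            hexp)
          · exact ((B - H).le_opNorm _).trans (by gcongr)
          · exact (A - H).le_opNorm _
      _ = (s + (‖A - H‖ + m * ρ)) * ‖a - f‖ := by ring
      _ ≤ _ := by
          have : 0 ≤ s := (norm_nonneg _).trans hBH
          gcongr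
  refine (hinj _).trans ?_
  gcongr

end IsRegularLoss

end Rate

/-! ### Rates in probability and asymptotic linearity -/

section Asymptotics

variable {d : ℕ} {𝓩 Ω : Type*} [MeasurableSpace 𝓩] [MeasurableSpace Ω]
  {L : 𝓩 → Vec d → ℝ} {Θ : Set (Vec d)} {P : Measure 𝓩} {θ₀ : Vec d} {G₁ G₂ : 𝓩 → ℝ}
  {μ : Measure Ω} [IsProbabilityMeasure μ] [IsProbabilityMeasure P] {Z : ℕ → Ω → 𝓩}

/-- The full sample is the degenerate subsample with selection probability one, so the results for
subsamples also cover the full-data estimator. -/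
theorem isUniformSubsampling_univ (hindep : iIndepFun Z μ) (N : ℕ) :
    IsUniformSubsampling μ Z N N fun _ _ => true where
  measurable _ _ := measurable_const
  indep := (hindep.precomp (g := fun i : Fin N => (i : ℕ)) Fin.val_injective).comp
    (fun _ z => (z, true)) fun _ => measurable_id.prodMk measurable_const
  indep_obs _ _ := indepFun_const_right _ _
  prob i hi := by
    have : (N : ℝ) ≠ 0 := by exact_mod_cast (Nat.zero_lt_of_lt hi).ne'
    simp [this]

theorem subsample_true (N : ℕ) : subsample N (fun _ => true) = Finset.range N := by
  simp [subsample]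

namespace IsRegularLoss

variable (h : IsRegularLoss L Θ P θ₀ G₁ G₂) (hZ : ∀ i, HasLaw (Z i) P μ)
  {n : ℕ → ℝ} {R : ℕ → ℕ → Ω → Bool} (hR : ∀ N, IsUniformSubsampling μ Z (n N) N (R N))
  (hn : Tendsto n atTop atTop) {b : ℕ → ℝ} (hb0 : ∀ N, 0 ≤ b N)
  (hb : Tendsto (fun N => b N ^ 2 / n N) atTop (𝓝 0))
include h hZ hR hn hb0 hb

/-- The population score is zero at `θ₀`, so the law of large numbers with rate applies to each
coordinate. -/
theorem tendsto_mul_norm_score :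
    Tendsto (fun x : ℕ × Ω => b x.1 * ‖score L (n x.1) (subsample x.1 fun i => R x.1 i x.2)
      (fun i => Z i x.2) θ₀‖) (probFilter μ) (𝓝 0) := by
  have hsum := tendsto_finsetSum Finset.univ fun (i : Fin d) _ =>
    tendsto_mul_wavg_sub (b := b) hR hZ (memLp_gradient_apply h.memLp_fderiv₁ i) hn hb
  simp only [Finset.sum_const_zero] at hsum
  refine squeeze_zero (fun x => mul_nonneg (hb0 _) (norm_nonneg _)) (fun x => ?_) hsum
  rw [← Finset.mul_sum]
  refine mul_le_mul_of_nonneg_left ((norm_le_sum_abs _).trans_eq ?_) (hb0 _)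
  refine Finset.sum_congr rfl fun i _ => ?_
  rw [integral_gradient_apply_eq_zero h.convex h.mem_interior h.meas h.smooth h.argmin h.lip₁
    h.memLp_fderiv₁ h.memLp_lip₁ i, sub_zero]
  simp [score, wavg]

theorem tendsto_mul_norm_meanHess_sub :
    Tendsto (fun x : ℕ × Ω => b x.1 * ‖meanHess L (n x.1) (subsample x.1 fun i => R x.1 i x.2)
      (fun i => Z i x.2) θ₀ - popHess L P θ₀‖) (probFilter μ) (𝓝 0) := by
  have hsum := tendsto_finsetSum Finset.univ fun (i : Fin d) _ =>
    tendsto_finsetSum Finset.univ fun (j : Fin d) _ =>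
    tendsto_mul_wavg_sub (b := b) hR hZ (memLp_hessian_apply h.memLp_fderiv₂ i j) hn hb
  simp only [Finset.sum_const_zero] at hsum
  refine squeeze_zero (fun x => mul_nonneg (hb0 _) (norm_nonneg _)) (fun x => ?_) hsum
  simp only [← Finset.mul_sum]
  rw [meanHess_eq, popHess, ← map_sub]
  refine mul_le_mul_of_nonneg_left ((norm_toEuclideanCLM_le_sum_abs _).trans_eq ?_) (hb0 _)
  refine Finset.sum_congr rfl fun i _ => Finset.sum_congr rfl fun j _ => ?_
  simp [wavg, meanHessian, Matrix.sum_apply]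

omit hb0 hb in
theorem tendsto_curvature_error {T : ℕ → Ω → Vec d}
    (hT : Tendsto (fun x : ℕ × Ω => ‖T x.1 x.2 - θ₀‖) (probFilter μ) (𝓝 0)) :
    Tendsto (fun x : ℕ × Ω => ‖meanHess L (n x.1) (subsample x.1 fun i => R x.1 i x.2)
      (fun i => Z i x.2) θ₀ - popHess L P θ₀‖ +
      wavg (n x.1) (subsample x.1 fun i => R x.1 i x.2) (fun i => Z i x.2) (fun z => |G₂ z|) *
        ‖T x.1 x.2 - θ₀‖) (probFilter μ) (𝓝 0) := by
  have h1 := h.tendsto_mul_norm_meanHess_sub hZ hR hn (b := fun _ => 1) (fun _ => zero_le_one)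
    (by simpa [Function.comp_def] using tendsto_inv_atTop_zero.comp hn)
  have h2 := (tendsto_wavg hR hZ h.memLp_lip₂.norm hn).mul hT
  simpa using h1.add h2

variable {T : ℕ → Ω → Vec d}
  (hT : ∀ᶠ x : ℕ × Ω in probFilter μ, IsMEstimate L Θ (subsample x.1 fun i => R x.1 i x.2)
      (fun i => Z i x.2) (T x.1 x.2)) (htight : IsTightIn μ Θ T)
include hT htight

omit hb0 hb in
theorem tendsto_norm_sub :
    Tendsto (fun x : ℕ × Ω => ‖T x.1 x.2 - θ₀‖) (probFilter μ) (𝓝 0) :=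
  tendsto_norm_sub_of_isMEstimate h.convex h.meas h.smooth h.argmin h.lip₁ h.memLp_fderiv₁
    h.memLp_lip₁ hZ hR hn hT htight

omit hb0 hb in
-- Consistency puts the estimator inside a ball contained in `Θ`, where the first-order condition
-- holds.
theorem eventually_score_eq_zero :
    ∀ᶠ x : ℕ × Ω in probFilter μ, 0 ≤ n x.1 ∧ Metric.closedBall θ₀ ‖T x.1 x.2 - θ₀‖ ⊆ Θ ∧
      score L (n x.1) (subsample x.1 fun i => R x.1 i x.2) (fun i => Z i x.2) (T x.1 x.2) = 0 := by
  obtain ⟨r, hr, hball⟩ := Metric.isOpen_iff.1 isOpen_interior θ₀ h.mem_interior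
  filter_upwards [(h.tendsto_norm_sub hZ hR hn hT htight).eventually_lt_const hr, hT,
    (tendsto_fst_probFilter μ).eventually (hn.eventually_ge_atTop 0)] with x hx hxT hxn
  refine ⟨hxn, ?_, h.score_eq_zero hxT (hball (by rwa [Metric.mem_ball, dist_eq_norm]))⟩
  exact (Metric.closedBall_subset_ball hx).trans (hball.trans interior_subset)

/-- The rate of convergence of M-estimators based on Bernoulli subsamples. -/
theorem tendsto_mul_norm_sub :
    Tendsto (fun x : ℕ × Ω => b x.1 * ‖T x.1 x.2 - θ₀‖) (probFilter μ) (𝓝 0) := by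
  set κ := ‖popHessInv L P θ₀‖ with hκ
  have h1 := h.tendsto_curvature_error hZ hR hn (h.tendsto_norm_sub hZ hR hn hT htight)
  have h2 := (h.tendsto_mul_norm_score hZ hR hn hb0 hb).const_mul (2 * κ)
  rw [mul_zero] at h2
  have h3 := h1.const_mul κ
  rw [mul_zero] at h3
  refine squeeze_zero' (Eventually.of_forall fun x => mul_nonneg (hb0 _) (norm_nonneg _)) ?_ h2
  filter_upwards [h3.eventually_le_const (one_half_pos), h.eventually_score_eq_zero hZ hR hn hT
    htight] with x hx ⟨hxn, hball, hx0⟩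
  have h4 := h.norm_score_add_popHess_le hxn hball hx0
  set S := subsample x.1 fun i => R x.1 i x.2
  set U := score L (n x.1) S (fun i => Z i x.2) θ₀
  set e := ‖meanHess L (n x.1) S (fun i => Z i x.2) θ₀ - popHess L P θ₀‖ +
      wavg (n x.1) S (fun i => Z i x.2) (fun z => |G₂ z|) * ‖T x.1 x.2 - θ₀‖
  have h5 : ‖popHess L P θ₀ (T x.1 x.2 - θ₀)‖ ≤ ‖U‖ + e * ‖T x.1 x.2 - θ₀‖ := by
    have h6 := norm_sub_le (U + popHess L P θ₀ (T x.1 x.2 - θ₀)) U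
    rw [add_sub_cancel_left] at h6
    linarith
  have h6 := h.norm_le (T x.1 x.2 - θ₀)
  rw [← hκ] at h6
  have h7 : κ * ‖popHess L P θ₀ (T x.1 x.2 - θ₀)‖ ≤ κ * (‖U‖ + e * ‖T x.1 x.2 - θ₀‖) := by gcongr
  -- The curvature error times `κ` is at most one half, so this term moves to the left side; that is
  -- the source of the factor `2` in front of `κ`.
  have h8 : κ * e * ‖T x.1 x.2 - θ₀‖ ≤ 1 / 2 * ‖T x.1 x.2 - θ₀‖ := by gcongr
  calc _ ≤ b x.1 * (2 * κ * ‖U‖) := mul_le_mul_of_nonneg_left (by linarith) (hb0 _)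
    _ = _ := by ring

/-- The mean of `|G₂|` converges, so the second summand inherits the rate of `T`. -/
theorem tendsto_mul_curvature_error :
    Tendsto (fun x : ℕ × Ω => b x.1 * (‖meanHess L (n x.1)
      (subsample x.1 fun i => R x.1 i x.2) (fun i => Z i x.2) θ₀ - popHess L P θ₀‖ +
      wavg (n x.1) (subsample x.1 fun i => R x.1 i x.2) (fun i => Z i x.2) (fun z => |G₂ z|) *
        ‖T x.1 x.2 - θ₀‖)) (probFilter μ) (𝓝 0) := by
  have h1 := h.tendsto_mul_norm_meanHess_sub hZ hR hn hb0 hb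
  have h2 := (tendsto_wavg hR hZ h.memLp_lip₂.norm hn).mul
    (h.tendsto_mul_norm_sub hZ hR hn hb0 hb hT htight)
  have h3 := h1.add h2
  rw [mul_zero, add_zero] at h3
  refine h3.congr fun x => ?_
  simp only [Real.norm_eq_abs]
  ring

/-- Asymptotic linearity of M-estimators. -/
theorem tendsto_sq_mul_norm_add_popHessInv_score :
    Tendsto (fun x : ℕ × Ω => ‖b x.1 ^ 2 • (T x.1 x.2 - θ₀ + popHessInv L P θ₀
      (score L (n x.1) (subsample x.1 fun i => R x.1 i x.2) (fun i => Z i x.2) θ₀))‖)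
      (probFilter μ) (𝓝 0) := by
  have h1 := ((h.tendsto_mul_curvature_error hZ hR hn hb0 hb hT htight).mul
    (h.tendsto_mul_norm_sub hZ hR hn hb0 hb hT htight)).const_mul ‖popHessInv L P θ₀‖
  rw [mul_zero, mul_zero] at h1
  refine squeeze_zero' (Eventually.of_forall fun x => norm_nonneg _) ?_ h1
  filter_upwards [h.eventually_score_eq_zero hZ hR hn hT htight] with x ⟨hxn, hball, hx0⟩
  have h4 := h.norm_score_add_popHess_le hxn hball hx0
  set S := subsample x.1 fun i => R x.1 i x.2
  set U := score L (n x.1) S (fun i => Z i x.2) θ₀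
  have h5 : T x.1 x.2 - θ₀ + popHessInv L P θ₀ U =
      popHessInv L P θ₀ (U + popHess L P θ₀ (T x.1 x.2 - θ₀)) := by
    rw [map_add, h.popHessInv_popHess, add_comm]
  rw [h5, norm_smul, Real.norm_of_nonneg (sq_nonneg _)]
  have h6 := (popHessInv L P θ₀).le_opNorm (U + popHess L P θ₀ (T x.1 x.2 - θ₀))
  refine (mul_le_mul_of_nonneg_left (h6.trans (mul_le_mul_of_nonneg_left h4 (norm_nonneg _)))
    (sq_nonneg (b x.1))).trans_eq ?_
  ring

end IsRegularLoss

/-- The one-step estimator and the full-data estimator are asymptotically equivalent. -/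
theorem IsRegularLoss.tendsto_sq_mul_norm_oneStep_sub (h : IsRegularLoss L Θ P θ₀ G₁ G₂)
    (hZ : ∀ i, HasLaw (Z i) P μ) (hindep : iIndepFun Z μ) {n : ℕ → ℝ} {R : ℕ → ℕ → Ω → Bool}
    (hR : ∀ N, IsUniformSubsampling μ Z (n N) N (R N)) (hn : Tendsto n atTop atTop) {b : ℕ → ℝ}
    (hb0 : ∀ N, 0 ≤ b N) (hb : Tendsto (fun N => b N ^ 2 / n N) atTop (𝓝 0))
    (hbN : Tendsto (fun N : ℕ => b N ^ 2 / N) atTop (𝓝 0)) {T F : ℕ → Ω → Vec d}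
    (hT : ∀ᶠ x : ℕ × Ω in probFilter μ, IsMEstimate L Θ (subsample x.1 fun i => R x.1 i x.2)
      (fun i => Z i x.2) (T x.1 x.2)) (hTt : IsTightIn μ Θ T)
    (hF : ∀ᶠ x : ℕ × Ω in probFilter μ, IsMEstimate L Θ (Finset.range x.1)
      (fun i => Z i x.2) (F x.1 x.2)) (hFt : IsTightIn μ Θ F) :
    Tendsto (fun x : ℕ × Ω => ‖b x.1 ^ 2 • (oneStep L (n x.1) x.1
      (subsample x.1 fun i => R x.1 i x.2) (fun i => Z i x.2) (T x.1 x.2) - F x.1 x.2)‖)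
      (probFilter μ) (𝓝 0) := by
  have hN : Tendsto (fun N : ℕ => (N : ℝ)) atTop atTop := tendsto_natCast_atTop_atTop
  have hRN := isUniformSubsampling_univ hindep
  have hF' : ∀ᶠ x : ℕ × Ω in probFilter μ, IsMEstimate L Θ (subsample x.1 fun _ => true)
      (fun i => Z i x.2) (F x.1 x.2) := by simpa only [subsample_true] using hF
  have rT := h.tendsto_mul_norm_sub hZ hR hn hb0 hb hT hTt
  have rF := h.tendsto_mul_norm_sub hZ hRN hN hb0 hbN hF' hFt
  have cT := h.tendsto_norm_sub hZ hR hn hT hTt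
  have cF := h.tendsto_norm_sub hZ hRN hN hF' hFt
  have eT := h.tendsto_mul_curvature_error hZ hR hn hb0 hb hT hTt
  have eN := h.tendsto_mul_norm_meanHess_sub hZ hRN hN hb0 hbN
  have wN := tendsto_wavg hRN hZ h.memLp_lip₂.norm hN
  -- One factor `b` goes to the curvature errors and the other to the distances from `θ₀`; together
  -- they produce the required `b²`.
  have hlim := ((eT.add (eN.add (wN.mul (rT.add rF)))).mul (rT.add rF)).const_mul
    (2 * ‖popHessInv L P θ₀‖)
  simp only [add_zero, mul_zero] at hlim
  refine squeeze_zero' (Eventually.of_forall fun x => norm_nonneg _) ?_ hlim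
  obtain ⟨r, hr, hball⟩ := Metric.isOpen_iff.1 isOpen_interior θ₀ h.mem_interior
  have hr' := cT.add cF
  rw [add_zero] at hr'
  have hsmall := (h.tendsto_curvature_error hZ hR hn cT).const_mul ‖popHessInv L P θ₀‖
  rw [mul_zero] at hsmall
  filter_upwards [hr'.eventually_lt_const hr, hsmall.eventually_le_const one_half_pos,
    h.eventually_score_eq_zero hZ hR hn hT hTt, h.eventually_score_eq_zero hZ hRN hN hF' hFt]
    with x hxr hxs ⟨hxn, _, _⟩ ⟨_, _, hxF⟩
  simp only [subsample_true] at hxF ⊢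
  have h1 := h.norm_oneStep_sub_le hxn
    ((Metric.closedBall_subset_ball hxr).trans (hball.trans interior_subset)) hxF hxs
  rw [norm_smul, Real.norm_of_nonneg (sq_nonneg _)]
  refine (mul_le_mul_of_nonneg_left h1 (sq_nonneg (b x.1))).trans_eq ?_
  simp only [Real.norm_eq_abs]
  ring

end Asymptotics

/-! ### Central limit theorem for the normalized score -/

section CentralLimit

variable {d : ℕ} {𝓩 Ω : Type*} [MeasurableSpace 𝓩] [MeasurableSpace Ω] {μ : Measure Ω}
  [IsProbabilityMeasure μ]

/-- The multivariate central limit theorem for centred summands. -/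
theorem tendstoInDistribution_multivariateGaussian {Y : ℕ → Ω → Vec d} (hindep : iIndepFun Y μ)
    (hident : ∀ i, IdentDistrib (Y i) (Y 0) μ μ) (hY : MemLp (Y 0) 2 μ)
    {V : Matrix (Fin d) (Fin d) ℝ} (hV : V.PosSemidef)
    (h0 : ∀ t : Vec d, ∫ ω, inner ℝ (Y 0 ω) t ∂μ = 0)
    (hcov : ∀ t : Vec d, ∫ ω, inner ℝ (Y 0 ω) t ^ 2 ∂μ = t.ofLp ⬝ᵥ V.mulVec t.ofLp) :
    TendstoInDistribution (fun (N : ℕ) ω => (√(N : ℝ))⁻¹ • ∑ i ∈ Finset.range N, Y i ω) atTop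
      (id : Vec d → Vec d) (fun _ => μ) (multivariateGaussian 0 V) where
  forall_aemeasurable N := (Finset.aemeasurable_fun_sum _ fun i _ =>
    (hident i).aemeasurable_fst).fun_const_smul _
  tendsto := by
    refine ProbabilityMeasure.tendsto_iff_tendsto_charFun.2 fun t => ?_
    have hm : Measurable fun y : Vec d => inner ℝ y t := by fun_prop
    set X : ℕ → Ω → ℝ := fun i ω => inner ℝ (Y i ω) t with hX
    have hX2 : MemLp (X 0) 2 μ := hY.inner_const t
    have hXident : ∀ i, IdentDistrib (X i) (X 0) μ μ := fun i => (hident i).comp hm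
    have hXindep : iIndepFun X μ := hindep.comp (fun _ y => inner ℝ y t) fun _ => hm
    have hvar : variance (X 0) μ = t.ofLp ⬝ᵥ V.mulVec t.ofLp := by
      rw [variance_of_integral_eq_zero hX2.aestronglyMeasurable.aemeasurable (h0 t), ← hcov t]
    -- Cramér–Wold: the characteristic function at `t` is that of the projection onto `t` at
    -- frequency `1`, so the scalar theorem suffices.
    have hclt := tendstoInDistribution_inv_sqrt_mul_sum_sub (P := μ)
      (P' := gaussianReal 0 (variance (X 0) μ).toNNReal) (Y := id) HasLaw.id hX2 hXindep hXident
    have hchar := ProbabilityMeasure.tendsto_iff_tendsto_charFun.1 hclt.tendsto 1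
    have hmeasY : ∀ N : ℕ, AEMeasurable
        (fun ω => (√(N : ℝ))⁻¹ • ∑ i ∈ Finset.range N, Y i ω) μ := fun N =>
      (Finset.aemeasurable_fun_sum _ fun i _ => (hident i).aemeasurable_fst).fun_const_smul _
    convert! hchar using 1
    · ext N
      change charFun (μ.map _) t = charFun (μ.map _) 1
      rw [charFun_apply, charFun_apply, integral_map (hmeasY N) (by fun_prop),
        integral_map (hclt.forall_aemeasurable N) (by fun_prop)]
      congr 1
      ext ω
      have e : inner ℝ ((√(N : ℝ))⁻¹ • ∑ i ∈ Finset.range N, Y i ω) t =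
          (√(N : ℝ))⁻¹ * (∑ k ∈ Finset.range N, X k ω - N * ∫ ω, X 0 ω ∂μ) := by
        rw [h0 t, mul_zero, sub_zero, real_inner_smul_left, sum_inner]
      rw [e]
      simp
    · change 𝓝 (charFun ((multivariateGaussian 0 V).map id) t) =
        𝓝 (charFun ((gaussianReal 0 _).map id) 1)
      rw [Measure.map_id, Measure.map_id, charFun_multivariateGaussian hV, charFun_gaussianReal]
      have hnn : 0 ≤ t.ofLp ⬝ᵥ V.mulVec t.ofLp := by
        rw [← hvar]; exact variance_nonneg _ _
      simp [hvar, hnn]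

variable {L : 𝓩 → Vec d → ℝ} {Θ : Set (Vec d)} {P : Measure 𝓩} [IsProbabilityMeasure P]
  {θ₀ : Vec d} {G₁ G₂ : 𝓩 → ℝ} {Z : ℕ → Ω → 𝓩}

theorem memLp_gradient {p : ENNReal}
    (hD : MemLp (fun z => iteratedFDeriv ℝ 1 (L z) θ₀) p P) :
    MemLp (fun z => gradient (L z) θ₀) p P := by
  have hfd : (fun z => gradient (L z) θ₀) = fun z => (InnerProductSpace.toDual ℝ (Vec d)).symm
      (continuousMultilinearCurryFin1 ℝ (Vec d) ℝ (iteratedFDeriv ℝ 1 (L z) θ₀)) := by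
    ext1 z
    rw [gradient]
    congr 1
    ext v; simp
  rw [hfd]
  refine hD.mono ?_ (Eventually.of_forall fun z => by simp)
  exact ((InnerProductSpace.toDual ℝ (Vec d)).symm.continuous.comp
    (continuousMultilinearCurryFin1 ℝ (Vec d) ℝ).continuous).comp_aestronglyMeasurable
      hD.aestronglyMeasurable

namespace IsRegularLoss

variable (h : IsRegularLoss L Θ P θ₀ G₁ G₂)
include h

theorem transpose_meanHessian_inv : (meanHessian L P θ₀)⁻¹.transpose = (meanHessian L P θ₀)⁻¹ := by
  rw [Matrix.transpose_nonsing_inv]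
  congr 1
  ext i j
  exact meanHessian_symm h.mem h.smooth j i

/-- Symmetry of `H⁻¹` moves it onto `t`, leaving a linear combination of coordinates of `x` that can
be integrated termwise. -/
theorem inner_popHessInv (x t : Vec d) :
    inner ℝ (popHessInv L P θ₀ x) t =
      ∑ i, (meanHessian L P θ₀)⁻¹.mulVec t.ofLp i * x i := by
  rw [real_inner_comm, popHessInv, Matrix.inner_toEuclideanCLM, Matrix.dotProduct_mulVec,
    ← Matrix.mulVec_transpose, h.transpose_meanHessian_inv]
  rfl

theorem integral_inner_popHessInv_gradient (t : Vec d) :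
    ∫ z, inner ℝ (-popHessInv L P θ₀ (gradient (L z) θ₀)) t ∂P = 0 := by
  simp only [inner_neg_left, h.inner_popHessInv]
  rw [integral_neg, integral_finsetSum]
  · simp only [integral_const_mul, integral_gradient_apply_eq_zero h.convex h.mem_interior h.meas
      h.smooth h.argmin h.lip₁ h.memLp_fderiv₁ h.memLp_lip₁]
    simp
  · exact fun i _ => ((memLp_gradient_apply h.memLp_fderiv₁ i).integrable one_le_two).const_mul _

theorem integral_inner_sq_popHessInv_gradient (t : Vec d) :
    ∫ z, inner ℝ (-popHessInv L P θ₀ (gradient (L z) θ₀)) t ^ 2 ∂P =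
      t.ofLp ⬝ᵥ ((meanHessian L P θ₀)⁻¹ * gradientSecondMoment L P θ₀ *
        (meanHessian L P θ₀)⁻¹).mulVec t.ofLp := by
  set s := (meanHessian L P θ₀)⁻¹.mulVec t.ofLp with hs
  have e1 : t.ofLp ⬝ᵥ ((meanHessian L P θ₀)⁻¹ * gradientSecondMoment L P θ₀ *
      (meanHessian L P θ₀)⁻¹).mulVec t.ofLp = s ⬝ᵥ (gradientSecondMoment L P θ₀).mulVec s := by
    rw [← Matrix.mulVec_mulVec, ← Matrix.mulVec_mulVec, Matrix.dotProduct_mulVec,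
      ← Matrix.mulVec_transpose, h.transpose_meanHessian_inv]
  have e2 : ∀ z, inner ℝ (-popHessInv L P θ₀ (gradient (L z) θ₀)) t ^ 2 =
      ∑ i, ∑ j, s i * s j * (gradient (L z) θ₀ i * gradient (L z) θ₀ j) := by
    intro z
    rw [inner_neg_left, h.inner_popHessInv, neg_sq, sq, Finset.sum_mul_sum]
    refine Finset.sum_congr rfl fun i _ => Finset.sum_congr rfl fun j _ => ?_
    ring
  have hint : ∀ i j, Integrable (fun z => s i * s j *
      (gradient (L z) θ₀ i * gradient (L z) θ₀ j)) P := fun i j =>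
    ((memLp_gradient_apply h.memLp_fderiv₁ i).integrable_mul
      (memLp_gradient_apply h.memLp_fderiv₁ j)).const_mul _
  rw [e1]
  simp only [e2]
  rw [integral_finsetSum _ fun i _ => integrable_finsetSum _ fun j _ => hint i j]
  simp only [dotProduct, Matrix.mulVec, Finset.mul_sum]
  refine Finset.sum_congr rfl fun i _ => ?_
  rw [integral_finsetSum _ fun j _ => hint i j]
  refine Finset.sum_congr rfl fun j _ => ?_
  rw [integral_const_mul, gradientSecondMoment, Matrix.of_apply]
  ring

/-- Its quadratic form is the second moment of a linear functional of the transformed gradient,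
hence nonnegative. -/
theorem posSemidef_sandwich : ((meanHessian L P θ₀)⁻¹ * gradientSecondMoment L P θ₀ *
    (meanHessian L P θ₀)⁻¹).PosSemidef := by
  refine .of_dotProduct_mulVec_nonneg ?_ fun x => ?_
  · rw [Matrix.IsHermitian, Matrix.conjTranspose_eq_transpose_of_trivial, Matrix.transpose_mul,
      Matrix.transpose_mul, h.transpose_meanHessian_inv, mul_assoc]
    congr 2
    ext i j
    simp [gradientSecondMoment, mul_comm]
  · rw [star_trivial]
    have := h.integral_inner_sq_popHessInv_gradient (WithLp.toLp 2 x)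
    rw [← this]
    exact integral_nonneg fun z => sq_nonneg _

theorem tendstoInDistribution_score (hZ : ∀ i, HasLaw (Z i) P μ) (hindep : iIndepFun Z μ) :
    TendstoInDistribution (fun (N : ℕ) ω => -(√(N : ℝ) • popHessInv L P θ₀
      (score L N (Finset.range N) (fun i => Z i ω) θ₀))) atTop (id : Vec d → Vec d) (fun _ => μ)
      (multivariateGaussian 0 ((meanHessian L P θ₀)⁻¹ * gradientSecondMoment L P θ₀ *
        (meanHessian L P θ₀)⁻¹)) := by
  set φ : 𝓩 → Vec d := fun z => -popHessInv L P θ₀ (gradient (L z) θ₀) with hφ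
  have hφ2 : MemLp φ 2 P := ((popHessInv L P θ₀).comp_memLp' (memLp_gradient h.memLp_fderiv₁)).neg
  have hφm : ∀ i, AEMeasurable φ (μ.map (Z i)) := fun i => by
    rw [(hZ i).map_eq]; exact hφ2.aestronglyMeasurable.aemeasurable
  have hint : ∀ g : Vec d → ℝ, Continuous g → ∫ ω, g (φ (Z 0 ω)) ∂μ = ∫ z, g (φ z) ∂P := by
    intro g hg
    rw [← (hZ 0).map_eq, integral_map (hZ 0).aemeasurable]
    exact hg.comp_aestronglyMeasurable (hφm 0).aestronglyMeasurable
  have hid : ∀ i, IdentDistrib (Z i) (Z 0) μ μ := fun i =>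
    ⟨(hZ i).aemeasurable, (hZ 0).aemeasurable, by rw [(hZ i).map_eq, (hZ 0).map_eq]⟩
  have hφ0 : MemLp φ 2 (μ.map (Z 0)) := by rwa [(hZ 0).map_eq]
  have hclt := tendstoInDistribution_multivariateGaussian (μ := μ) (Y := fun i ω => φ (Z i ω))
    (hindep.comp₀ (fun _ => φ) (fun i => (hZ i).aemeasurable) hφm)
    (fun i => (hid i).comp_of_aemeasurable (hφm i)) (hφ0.comp_of_map (hZ 0).aemeasurable)
    h.posSemidef_sandwich
    (fun t => (hint (fun y => inner ℝ y t) (by fun_prop)).trans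
      (h.integral_inner_popHessInv_gradient t))
    (fun t => (hint (fun y => inner ℝ y t ^ 2) (by fun_prop)).trans
      (h.integral_inner_sq_popHessInv_gradient t))
  convert hclt using 3 with N ω
  simp only [score, wavg, map_smul, map_sum, hφ, Finset.sum_neg_distrib, smul_neg, smul_smul]
  -- The scale factors agree, `√N * N⁻¹ = (√N)⁻¹`, including at `N = 0`, where both are `0`.
  rw [← div_eq_mul_inv, Real.sqrt_div_self]

end IsRegularLoss

end CentralLimit

/-! ### Measurability of the one-step estimator -/

section Measurability

variable {d : ℕ} {𝓩 Ω : Type*} [MeasurableSpace 𝓩] [MeasurableSpace Ω] {μ : Measure Ω}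
  {Θ : Set (Vec d)} {θ₀ : Vec d}

/-- In the interior the derivative is a limit of difference quotients. A boundary point is
approached along the segment to `θ₀`, which is interior by convexity, and the derivative is
continuous there. -/
theorem measurable_fderiv_apply (hΘ : Convex ℝ Θ) (hθ₀ : θ₀ ∈ interior Θ)
    {F : 𝓩 → Vec d → ℝ} (hmeas : ∀ θ ∈ Θ, Measurable fun z => F z θ)
    (hF : ∀ z, ∀ θ ∈ Θ, ContDiffAt ℝ 1 (F z) θ) (v : Vec d) {θ : Vec d} (hθ : θ ∈ Θ) :
    Measurable fun z => fderiv ℝ (F z) θ v := by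
  have hint : ∀ θ ∈ interior Θ, Measurable fun z => fderiv ℝ (F z) θ v := by
    intro θ hθ
    have hlim : Tendsto (fun k : ℕ => θ + (k : ℝ)⁻¹ • v) atTop (𝓝 θ) := by
      have : Tendsto (fun k : ℕ => θ + (k : ℝ)⁻¹ • v) atTop (𝓝 (θ + (0 : ℝ) • v)) :=
        tendsto_const_nhds.add (tendsto_inv_atTop_nhds_zero_nat.smul_const v)
      simpa using this
    -- Measurability of `F` is known only on `Θ`; the shift by `k` keeps every evaluation point in
    -- it.
    obtain ⟨k, hk⟩ := eventually_atTop.1 (hlim.eventually (mem_interior_iff_mem_nhds.1 hθ))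
    refine measurable_of_tendsto_metrizable (f := fun (m : ℕ) z => ((m + k : ℕ) : ℝ) •
      (F z (θ + ((m + k : ℕ) : ℝ)⁻¹ • v) - F z θ)) (fun m => ?_) (tendsto_pi_nhds.2 fun z => ?_)
    · exact ((hmeas _ (hk (m + k) (Nat.le_add_left _ _))).sub
        (hmeas θ (interior_subset hθ))).const_mul _
    · refine ((hF z θ (interior_subset hθ)).differentiableAt one_ne_zero).hasFDerivAt.lim v ?_
      have := (tendsto_natCast_atTop_atTop (R := ℝ)).comp (tendsto_add_atTop_nat k)
      exact tendsto_norm_atTop_atTop.comp this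
  set x : ℕ → Vec d := fun m => θ + ((m : ℝ) + 1)⁻¹ • (θ₀ - θ) with hx
  have hxint : ∀ m, x m ∈ interior Θ := fun m => by
    refine hΘ.add_smul_sub_mem_interior hθ hθ₀ ⟨by positivity, inv_le_one_of_one_le₀ ?_⟩
    simp
  have hxlim : Tendsto x atTop (𝓝 θ) := by
    have h1 : Tendsto (fun m : ℕ => ((m : ℝ) + 1)⁻¹) atTop (𝓝 0) := by
      simpa using tendsto_one_div_add_atTop_nhds_zero_nat (𝕜 := ℝ)
    have : Tendsto x atTop (𝓝 (θ + (0 : ℝ) • (θ₀ - θ))) :=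
      tendsto_const_nhds.add (h1.smul_const _)
    simpa using this
  refine measurable_of_tendsto_metrizable (fun m => hint (x m) (hxint m))
    (tendsto_pi_nhds.2 fun z => ?_)
  have hc : ContinuousAt (fderiv ℝ (F z)) θ := (hF z θ hθ).continuousAt_fderiv one_ne_zero
  exact ((ContinuousLinearMap.apply ℝ ℝ v).continuous.tendsto _).comp (hc.tendsto.comp hxlim)

/-- A Carathéodory function, continuous in `θ` and measurable in `z`, is jointly measurable on `Θ ×
𝓩`. -/
theorem aemeasurable_comp_of_continuousAt {F : 𝓩 → Vec d → ℝ}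
    (hmeas : ∀ θ ∈ Θ, Measurable fun z => F z θ) (hF : ∀ z, ∀ θ ∈ Θ, ContinuousAt (F z) θ)
    {W : Ω → 𝓩} (hW : AEMeasurable W μ) {T : Ω → Vec d} (hT : Measurable T)
    (hTΘ : ∀ ω, T ω ∈ Θ) : AEMeasurable (fun ω => F (W ω) (T ω)) μ := by
  have h1 : Measurable (Function.uncurry fun (θ : Θ) (z : 𝓩) => F z θ) :=
    measurable_uncurry_of_continuous_of_measurable
      (fun z => continuous_iff_continuousAt.2 fun θ =>
        (hF z θ θ.2).comp continuous_subtype_val.continuousAt)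
      (fun θ => hmeas θ θ.2)
  exact h1.comp_aemeasurable ((hT.subtype_mk (h := hTΘ)).aemeasurable.prodMk hW)

/-- Inverse determinant times adjugate; this covers singular matrices too, since both conventions
return `0` there. -/
theorem measurable_matrix_inv_apply (i j : Fin d) :
    Measurable fun m : Fin d → Fin d → ℝ => (Matrix.of m)⁻¹ i j := by
  have hid : Continuous fun m : Fin d → Fin d → ℝ => Matrix.of m := continuous_id
  have h1 : Measurable fun m : Fin d → Fin d → ℝ => (Matrix.of m).det := hid.matrix_det.measurable
  have h2 : Measurable fun m : Fin d → Fin d → ℝ => (Matrix.of m).adjugate i j :=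
    (hid.matrix_adjugate.matrix_elem i j).measurable
  simp only [Matrix.inv_def, Ring.inverse_eq_inv', Matrix.smul_apply, smul_eq_mul]
  exact h1.inv.mul h2

variable {L : 𝓩 → Vec d → ℝ} {P : Measure 𝓩} {Z : ℕ → Ω → 𝓩}

/-- Convergence in distribution presupposes a.e. measurability, which for the one-step estimator
must be derived from its formula. -/
theorem aemeasurable_oneStep (hΘ : Convex ℝ Θ) (hθ₀ : θ₀ ∈ interior Θ)
    (hmeas : ∀ θ ∈ Θ, Measurable fun z => L z θ)
    (hsmooth : ∀ z, ∀ θ ∈ Θ, ContDiffAt ℝ 3 (L z) θ) (hZ : ∀ i, AEMeasurable (Z i) μ)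
    {n : ℝ} {N : ℕ} {R : ℕ → Ω → Bool} (hR : ∀ i < N, Measurable (R i)) {T : Ω → Vec d}
    (hT : Measurable T) (hTΘ : ∀ ω, T ω ∈ Θ) :
    AEMeasurable (fun ω => oneStep L n N (subsample N fun i => R i ω) (fun i => Z i ω) (T ω))
      μ := by
  have hfd : ∀ z, ∀ θ ∈ Θ, ContDiffAt ℝ 2 (fderiv ℝ (L z)) θ := fun z θ hθ =>
    (hsmooth z θ hθ).fderiv_right (by norm_num)
  have hfdv : ∀ v : Vec d, ∀ z, ∀ θ ∈ Θ, ContDiffAt ℝ 2 (fun θ => fderiv ℝ (L z) θ v) θ :=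
    fun v z θ hθ => (hfd z θ hθ).clm_apply contDiffAt_const
  have hm1 : ∀ v : Vec d, ∀ θ ∈ Θ, Measurable fun z => fderiv ℝ (L z) θ v := fun v θ hθ =>
    measurable_fderiv_apply hΘ hθ₀ hmeas (fun z θ hθ => (hsmooth z θ hθ).of_le (by norm_num)) v hθ
  have hgrad : ∀ i k, AEMeasurable (fun ω => gradient (L (Z i ω)) (T ω) k) μ := fun i k => by
    simp only [gradient_apply]
    exact aemeasurable_comp_of_continuousAt (F := fun z θ => fderiv ℝ (L z) θ _) (hm1 _)
      (fun z θ hθ => (hfdv _ z θ hθ).continuousAt) (hZ i) hT hTΘ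
  have hhess : ∀ i j k, AEMeasurable (fun ω => hessian (L (Z i ω)) (T ω) j k) μ :=
    fun i j k => by
    have e : ∀ z, ∀ θ ∈ Θ, hessian (L z) θ j k = fderiv ℝ
        (fun θ => fderiv ℝ (L z) θ (EuclideanSpace.single k 1)) θ (EuclideanSpace.single j 1) := by
      intro z θ hθ
      rw [hessian_apply, fderiv_clm_apply ((hfd z θ hθ).differentiableAt (by norm_num))
        (differentiableAt_const _)]
      simp
    have e' : (fun ω => hessian (L (Z i ω)) (T ω) j k) = fun ω => fderiv ℝ
        (fun θ => fderiv ℝ (L (Z i ω)) θ (EuclideanSpace.single k 1)) (T ω)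
          (EuclideanSpace.single j 1) := funext fun ω => e _ _ (hTΘ ω)
    rw [e']
    refine aemeasurable_comp_of_continuousAt (F := fun z θ => fderiv ℝ
        (fun θ => fderiv ℝ (L z) θ (EuclideanSpace.single k 1)) θ (EuclideanSpace.single j 1))
      (fun θ hθ => measurable_fderiv_apply hΘ hθ₀ (F := fun z θ => fderiv ℝ (L z) θ
        (EuclideanSpace.single k 1)) (hm1 _)
        (fun z θ hθ => (hfdv _ z θ hθ).of_le (by norm_num)) _ hθ)
      (fun z θ hθ => ?_) (hZ i) hT hTΘ
    exact ((hfdv _ z θ hθ).continuousAt_fderiv (by norm_num)).clm_apply continuousAt_const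
  have hM : ∀ j k, AEMeasurable (fun ω => (n⁻¹ • ∑ i ∈ subsample N fun i => R i ω,
      hessian (L (Z i ω)) (T ω)) j k) μ := by
    intro j k
    -- The sum over the random index set becomes a sum over a fixed range with indicators.
    simp only [subsample, Finset.sum_filter, Matrix.smul_apply, Matrix.sum_apply, smul_eq_mul]
    refine (Finset.aemeasurable_fun_sum _ fun i hi => ?_).const_mul _
    have hs : MeasurableSet {ω | R i ω = true} :=
      hR i (Finset.mem_range.1 hi) (measurableSet_singleton true)
    have := (hhess i j k).indicator hs
    refine this.congr (Eventually.of_forall fun ω => ?_)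
    simp only [Set.indicator_apply, Set.mem_ofPred_eq]
    split_ifs <;> rfl
  have hinv : ∀ j k, AEMeasurable (fun ω => (n⁻¹ • ∑ i ∈ subsample N fun i => R i ω,
      hessian (L (Z i ω)) (T ω))⁻¹ j k) μ := fun j k =>
    (measurable_matrix_inv_apply j k).comp_aemeasurable
      (aemeasurable_pi_iff.2 fun j => aemeasurable_pi_iff.2 fun k => hM j k)
  have hvec : AEMeasurable (fun ω => WithLp.toLp 2 fun j => T ω j - ∑ k,
      (n⁻¹ • ∑ i ∈ subsample N fun i => R i ω, hessian (L (Z i ω)) (T ω))⁻¹ j k *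
      ((N : ℝ)⁻¹ • ∑ i ∈ Finset.range N, gradient (L (Z i ω)) (T ω) k)) μ := by
    refine (WithLp.measurable_toLp 2 _).comp_aemeasurable (aemeasurable_pi_iff.2 fun j => ?_)
    have hTj : Measurable fun ω => T ω j := by fun_prop
    refine hTj.aemeasurable.sub (Finset.aemeasurable_fun_sum _ fun k _ => (hinv j k).mul ?_)
    exact (Finset.aemeasurable_fun_sum _ fun i _ => hgrad i k).const_mul _
  refine hvec.congr (Eventually.of_forall fun ω => ?_)
  ext j
  simp only [oneStep, PiLp.sub_apply, Matrix.ofLp_toLpLin, Matrix.toLin'_apply, Matrix.mulVec,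
    dotProduct, WithLp.ofLp_sum, WithLp.ofLp_smul, Pi.smul_apply,
    Finset.sum_apply]

end Measurability

end SOS

/-! ### The theorem: asymptotic equivalence and the common normal limit -/

theorem theorem2 {d : ℕ} {𝓩 Ω : Type*} [MeasurableSpace 𝓩] [MeasurableSpace Ω]
    -- the loss, the parameter space, the law of an observation, the true parameter
    (L : 𝓩 → SOS.Vec d → ℝ) (Θ : Set (SOS.Vec d))
    (P : Measure 𝓩) [IsProbabilityMeasure P] (θ₀ : SOS.Vec d)
    (hΘ : Convex ℝ Θ) (hθ₀ : θ₀ ∈ interior Θ)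
    (hmeas : ∀ θ ∈ Θ, Measurable fun z => L z θ)
    (hsmooth : ∀ z, ∀ θ ∈ Θ, ContDiffAt ℝ 3 (L z) θ)
    (hargmin : SOS.IsPopulationArgmin L Θ P θ₀)
    (hC1 : SOS.CondC1 L Θ P) (hC2 : SOS.CondC2 L P θ₀) (hC3 : SOS.CondC3 L P θ₀)
    -- i.i.d. observations and, for each `N`, a uniform subsample of expected size `n N`
    (μ : Measure Ω) [IsProbabilityMeasure μ] (Z : ℕ → Ω → 𝓩)
    (hZlaw : ∀ i, HasLaw (Z i) P μ) (hZindep : iIndepFun Z μ)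
    (n : ℕ → ℝ) (R : ℕ → ℕ → Ω → Bool)
    (hR : ∀ N, SOS.IsUniformSubsampling μ Z (n N) N (R N))
    (hn : Tendsto (fun N : ℕ => n N / √(N : ℝ)) atTop atTop)
    -- the full-data and the uniform subsampling M-estimators
    (θfull θuni : ℕ → Ω → SOS.Vec d)
    (hfull_meas : ∀ N, Measurable (θfull N)) (huni_meas : ∀ N, Measurable (θuni N))
    (hfull_mem : ∀ N ω, θfull N ω ∈ Θ) (huni_mem : ∀ N ω, θuni N ω ∈ Θ)
    (hfull : Tendsto (fun N => μ {ω | ¬ SOS.IsMEstimate L Θ (Finset.range N)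
      (fun i => Z i ω) (θfull N ω)}) atTop (𝓝 0))
    (huni : Tendsto (fun N => μ {ω | ¬ SOS.IsMEstimate L Θ (SOS.subsample N fun i => R N i ω)
      (fun i => Z i ω) (θuni N ω)}) atTop (𝓝 0))
    (hfull_tight : SOS.IsTightIn μ Θ θfull) (huni_tight : SOS.IsTightIn μ Θ θuni)
    -- the subsampled one-step estimator
    (θSOS : ℕ → Ω → SOS.Vec d)
    (hSOS : ∀ N ω, θSOS N ω = SOS.oneStep L (n N) N (SOS.subsample N fun i => R N i ω)
      (fun i => Z i ω) (θuni N ω))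
    -- the asymptotic covariance matrix
    (Vc : Matrix (Fin d) (Fin d) ℝ)
    (hVc : Vc = (SOS.meanHessian L P θ₀)⁻¹ * SOS.gradientSecondMoment L P θ₀ *
      (SOS.meanHessian L P θ₀)⁻¹) :
    TendstoInMeasure μ (fun (N : ℕ) ω => √(N : ℝ) • (θSOS N ω - θfull N ω)) atTop (fun _ => 0) ∧
    TendstoInDistribution (fun (N : ℕ) ω => √(N : ℝ) • (θSOS N ω - θ₀)) atTop
      (id : SOS.Vec d → SOS.Vec d) (fun _ => μ) (multivariateGaussian 0 Vc) ∧
    TendstoInDistribution (fun (N : ℕ) ω => √(N : ℝ) • (θfull N ω - θ₀)) atTop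
      (id : SOS.Vec d → SOS.Vec d) (fun _ => μ) (multivariateGaussian 0 Vc) := by
  obtain ⟨G, hG⟩ := hC1
  obtain ⟨hG₁, hlip₁⟩ := hG 1 (by simp)
  obtain ⟨hG₂, hlip₂⟩ := hG 2 (by simp)
  obtain ⟨τ, hτ, hD₁, hD₂, -⟩ := hC2
  have hexp : (2 : ENNReal) ≤ ENNReal.ofReal (2 + τ) := by
    rw [← ENNReal.ofReal_ofNat 2]
    exact ENNReal.ofReal_le_ofReal (by linarith)
  have h : SOS.IsRegularLoss L Θ P θ₀ (G 1) (G 2) :=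
    { convex := hΘ
      mem_interior := hθ₀
      meas := hmeas
      smooth := hsmooth
      argmin := hargmin
      lip₁ := hlip₁
      lip₂ := hlip₂
      memLp_lip₁ := hG₁
      memLp_lip₂ := hG₂
      memLp_fderiv₁ := hD₁.mono_exponent hexp
      memLp_fderiv₂ := hD₂.mono_exponent hexp
      isUnit_det := SOS.isUnit_det_meanHessian hC3 }
  have hsqrt : Tendsto (fun N : ℕ => √(N : ℝ)) atTop atTop :=
    Real.tendsto_sqrt_atTop.comp tendsto_natCast_atTop_atTop
  have hn' : Tendsto n atTop atTop := by
    refine (hn.atTop_mul_atTop₀ hsqrt).congr' ?_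
    filter_upwards [eventually_gt_atTop 0] with N hN
    have : √(N : ℝ) ≠ 0 := (Real.sqrt_pos.2 (by exact_mod_cast hN)).ne'
    field_simp
  -- The rate is `b N = N^(1/4)`, whose square is the scaling `√N` of the conclusion.
  have hb2 : ∀ N : ℕ, √√(N : ℝ) ^ 2 = √(N : ℝ) := fun N => Real.sq_sqrt (Real.sqrt_nonneg _)
  have hb : Tendsto (fun N : ℕ => √√(N : ℝ) ^ 2 / n N) atTop (𝓝 0) := by
    refine (tendsto_inv_atTop_zero.comp hn).congr fun N => ?_
    rw [hb2, Function.comp_apply, inv_div]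
  have hbN : Tendsto (fun N : ℕ => √√(N : ℝ) ^ 2 / N) atTop (𝓝 0) := by
    refine (tendsto_inv_atTop_zero.comp hsqrt).congr fun N => ?_
    rw [hb2, Function.comp_apply, Real.sqrt_div_self]
  have hb0 : ∀ N : ℕ, 0 ≤ √√(N : ℝ) := fun N => Real.sqrt_nonneg _
  have hfull' : ∀ᶠ x : ℕ × Ω in SOS.probFilter μ, SOS.IsMEstimate L Θ (Finset.range x.1)
      (fun i => Z i x.2) (θfull x.1 x.2) := hfull
  have hfull'' : ∀ᶠ x : ℕ × Ω in SOS.probFilter μ, SOS.IsMEstimate L Θ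
      (SOS.subsample x.1 fun _ => true) (fun i => Z i x.2) (θfull x.1 x.2) := by
    simpa only [SOS.subsample_true] using hfull'
  have hdiff : TendstoInMeasure μ (fun (N : ℕ) ω => √(N : ℝ) • (θSOS N ω - θfull N ω)) atTop
      (fun _ => 0) := by
    refine SOS.tendstoInMeasure_zero_of_probFilter ?_
    have := h.tendsto_sq_mul_norm_oneStep_sub hZlaw hZindep hR hn' hb0 hb hbN huni huni_tight
      hfull' hfull_tight
    simpa only [hb2, ← hSOS] using this
  have hlin : TendstoInMeasure μ (fun (N : ℕ) ω => √(N : ℝ) • (θfull N ω - θ₀ +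
      SOS.popHessInv L P θ₀ (SOS.score L N (Finset.range N) (fun i => Z i ω) θ₀))) atTop
      (fun _ => 0) := by
    refine SOS.tendstoInMeasure_zero_of_probFilter ?_
    have := h.tendsto_sq_mul_norm_add_popHessInv_score hZlaw (SOS.isUniformSubsampling_univ hZindep)
      tendsto_natCast_atTop_atTop hb0 hbN hfull'' hfull_tight
    simpa only [hb2, SOS.subsample_true] using this
  have hclt := h.tendstoInDistribution_score hZlaw hZindep
  rw [← hVc] at hclt
  have hlim : TendstoInDistribution (fun (N : ℕ) ω => √(N : ℝ) • (θfull N ω - θ₀)) atTop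
      (id : SOS.Vec d → SOS.Vec d) (fun _ => μ) (multivariateGaussian 0 Vc) := by
    -- Slutsky's lemma: the centred, scaled estimator and its linear approximation differ by
    -- `o_P(1)`.
    refine tendstoInDistribution_of_tendstoInMeasure_sub _ _ hclt ?_ fun N =>
      (((hfull_meas N).sub_const θ₀).const_smul √(N : ℝ)).aemeasurable
    convert! hlin using 2 with N
    ext1 ω
    simp only [Pi.sub_apply, smul_add, sub_neg_eq_add]
  refine ⟨hdiff, ?_, hlim⟩
  have hSOS_meas : ∀ N, AEMeasurable (θSOS N) μ := fun N =>
    (SOS.aemeasurable_oneStep hΘ hθ₀ hmeas hsmooth (fun i => (hZlaw i).aemeasurable)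
      (hR N).measurable (huni_meas N) (huni_mem N)).congr
      (Eventually.of_forall fun ω => (hSOS N ω).symm)
  refine tendstoInDistribution_of_tendstoInMeasure_sub _ _ hlim ?_ fun N =>
    ((hSOS_meas N).sub_const θ₀).const_smul √(N : ℝ)
  convert! hdiff using 2 with N
  ext1 ω
  simp only [Pi.sub_apply, ← smul_sub, sub_sub_sub_cancel_right]
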